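/- All posets are finite (the empty poset is allowed); $x\parallel y$ means that $x,y$ are incomparable. A poset $P$ is $(3+1)$-free if there are no $a<b<c$ and $d$ in $P$ with $d$ incomparable to each of $a,b,c$. **Parts.** Let $P$ be a $(3+1)$-free poset, and for $a\in P$ put $D_a=\{x: x<a\}$ and $U_a=\{x: x>a\}$. A *top of a tangle* is a connected component, with at least two vertices, of the graph on $P$ in which $a,b$ are adjacent when $D_a$ and $D_b$ are incomparable under inclusion; a *bottom of a tangle* is defined in the same way with $U_a,U_b$ in place of $D_a,D_b$. A *tangle* is a pair $(A,B)$ of a top $A$ and a bottom $B$ that are matched, i.e. there are $a,a'\in A$ and $b,b'\in B$ with $b<a$, $b'<a'$ and $a\parallel a'$, $b\parallel b'$, $a\parallel b'$, $a'\parallel b$. A *clone set* is an equivalence class, for the relation "$D_a=D_b$ and $U_a=U_b$", on the set of vertices that lie in no tangle. The *parts* of $P$ are its clone sets and its tangles. **Skeleta.** The level $\ell(a)$ of $a\in P$ is defined by letting $L_1$ be the set of minimal elements of $P$, $L_2$ the set of minimal elements of $P\setminus L_1$, and so on, with $\ell(a)=i$ for $a\in L_i$. A *compatible listing* of $P$ is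 a listing $(X_1,\dots,X_k)$ of all parts of $P$, each exactly once, such that for all $i\ne j$, $a\in X_i$, $b\in X_j$ one has $a<b$ exactly when $\ell(a)\le\ell(b)-2$, or $\ell(a)=\ell(b)-1$ and $i<j$. Let $M$ be the monoid generated by letters $c_i$, $t_{i\,i+1}$ ($i\ge1$) subject to the relations $c_ic_j=c_jc_i$ if $|i-j|\ge2$; $c_it_{j\,j+1}=t_{j\,j+1}c_i$ if $i\le j-2$ or $i\ge j+3$; $t_{i\,i+1}t_{j\,j+1}=t_{j\,j+1}t_{i\,i+1}$ if $|i-j|\ge3$. Replacing in a compatible listing each clone set on level $i$ by $c_i$, and each tangle with bottom on level $i$ and top on level $i+1$ by $t_{i\,i+1}$, gives a word. The words of all compatible listings of $P$ form the set of all words representing one element of $M$, which is called the *skeleton* of $P$. A *skeleton* is an element of $M$ that is the skeleton of some $(3+1)$-free poset; its number of clone sets is its number of letters $c_i$, and its number of tangles is its number of letters $t_{i\,i+1}$. **Theorem.** For all $r,s\ge0$ there are only finitely many skeleta with $r$ clone sets and $s$ tangles, and the ordinary generating function $$S(c,t)=\sum_{r,s\ge0}\bigl(\#\text{ of distinct skeleta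 with } r \text{ clone sets and } s \text{ tangles}\bigr)\,c^rt^s\in\mathbb{Q}[[c,t]]$$ is the unique formal power series in $\mathbb{Q}[[c,t]]$ satisfying $$S(c,t)=1+\frac{c}{1+c}\,S(c,t)^2+t\,S(c,t)^3 .$$ -/

import Mathlib

namespace ThreePlusOne

section Posets

variable {P : Type*} [PartialOrder P]

/-- `a ∥ b`: the two elements are incomparable. -/
def Incomp {Q : Type*} [PartialOrder Q] (a b : Q) : Prop := ¬ a ≤ b ∧ ¬ b ≤ a

/-- There are no `a < b < c` together with `d` incomparable to each of `a`, `b`, `c`. -/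
def IsThreePlusOneFree (P : Type*) [PartialOrder P] : Prop :=
  ¬ ∃ a b c d : P, a < b ∧ b < c ∧ Incomp d a ∧ Incomp d b ∧ Incomp d c

/-- The view `(D_a, P \ U_a)` from the vertex `a`, where `D_a = Set.Iio a` is the strict downset
of `a` and `U_a = Set.Ioi a` its strict upset. -/
def view (a : P) : Set P × Set P := (Set.Iio a, (Set.Ioi a)ᶜ)

/-- `a` and `b` are clones. -/
def IsClone (a b : P) : Prop := view a = view b

/-- The graph on `P` in which `a` and `b` are adjacent when the strict downsets `D_a` and `D_b`
are incomparable under inclusion. -/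
def topGraph (P : Type*) [PartialOrder P] : SimpleGraph P where
  Adj a b := Incomp (Set.Iio a) (Set.Iio b)
  symm := ⟨fun _ _ h => ⟨h.2, h.1⟩⟩
  loopless := ⟨fun _ h => h.1 le_rfl⟩

/-- The graph on `P` in which `a` and `b` are adjacent when the strict upsets `U_a` and `U_b`
are incomparable under inclusion. -/
def botGraph (P : Type*) [PartialOrder P] : SimpleGraph P where
  Adj a b := Incomp (Set.Ioi a) (Set.Ioi b)
  symm := ⟨fun _ _ h => ⟨h.2, h.1⟩⟩
  loopless := ⟨fun _ h => h.1 le_rfl⟩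

/-- `A` is the top of a tangle: a connected component of `topGraph P` with at least two
vertices. -/
def IsTangleTop (A : Set P) : Prop :=
  A.Nontrivial ∧ ∃ K : (topGraph P).ConnectedComponent, A = K.supp

/-- `B` is the bottom of a tangle: a connected component of `botGraph P` with at least two
vertices. -/
def IsTangleBottom (B : Set P) : Prop :=
  B.Nontrivial ∧ ∃ K : (botGraph P).ConnectedComponent, B = K.supp

/-- There is an induced `(2+2)` subposet with its two top vertices in `A` and its two bottom
vertices in `B`. -/
def Matched (A B : Set P) : Prop :=
  ∃ a ∈ A, ∃ a' ∈ A, ∃ b ∈ B, ∃ b' ∈ B,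
    b < a ∧ b' < a' ∧ Incomp a a' ∧ Incomp b b' ∧ Incomp a b' ∧ Incomp a' b

/-- A tangle is a matched pair of a top and a bottom of a tangle. -/
def IsTangle (A B : Set P) : Prop := IsTangleTop A ∧ IsTangleBottom B ∧ Matched A B

/-- The vertices that lie in no tangle. -/
def untangled (P : Type*) [PartialOrder P] : Set P :=
  {x | ¬ ∃ A B : Set P, IsTangle A B ∧ x ∈ A ∪ B}

/-- A clone set is an equivalence class of the relation `IsClone` on the vertices that lie in no
tangle. -/
def IsCloneSet (C : Set P) : Prop :=
  ∃ a ∈ untangled P, C = {b | b ∈ untangled P ∧ IsClone a b}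

/-- A candidate part of `P`: a set (for a clone set), or a pair of sets `(A, B)` (for a tangle
with top `A` and bottom `B`). -/
inductive Part (P : Type*) where
  | clones (C : Set P)
  | tangle (A B : Set P)

/-- The parts of `P` are its clone sets and its tangles. -/
def Part.IsPart : Part P → Prop
  | .clones C => IsCloneSet C
  | .tangle A B => IsTangle A B

/-- The set of vertices of a part. -/
def Part.verts {P : Type*} : Part P → Set P
  | .clones C => C
  | .tangle A B => A ∪ B

/-- The level of a vertex of a finite poset, numbered from `0`: level `0` consists of the minimal
vertices, level `1` of the minimal vertices among the others, and so on; see `level_eq_iff`. -/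
noncomputable def level (a : P) : ℕ := (Order.height a).toNat

/-- Level `i` consists of the minimal elements of what is left of the poset after the removal of
all levels below `i`. -/
theorem level_eq_iff [Finite P] (i : ℕ) (a : P) :
    level a = i ↔ Minimal (fun x : P => ∀ j < i, level x ≠ j) a := by
  have htop : ∀ x : P, Order.height x < ⊤ := by
    intro x
    have := Fintype.ofFinite P
    refine lt_of_le_of_lt (b := ((Fintype.card P : ℕ) : ℕ∞)) ?_ (ENat.natCast_lt_top _)
    refine Order.height_le fun p _ => ?_
    exact_mod_cast p.length_lt_card.le
  have hfin : ∀ x : P, ((level x : ℕ) : ℕ∞) = Order.height x := by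
    intro x
    exact ENat.natCast_toNat (ne_of_lt (htop x))
  have hlt : ∀ x y : P, x < y → level x < level y := by
    intro x y hxy
    have h := Order.height_strictMono hxy (htop x)
    rw [← hfin, ← hfin] at h
    exact_mod_cast h
  have hle : ∀ x : P, (∀ j < i, level x ≠ j) ↔ i ≤ level x := by
    intro x
    refine ⟨fun h => ?_, fun h j hj => by omega⟩
    by_contra hc
    exact h (level x) (by omega) rfl
  simp only [hle]
  constructor
  · rintro rfl
    refine ⟨le_rfl, fun y hy hya => ?_⟩
    rcases hya.lt_or_eq with h | h
    · exact absurd (hlt y a h) (by omega)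
    · exact h.ge
  · rintro ⟨h1, h2⟩
    by_contra hne
    have hi : (i : ℕ∞) < Order.height a := by
      rw [← hfin]; exact_mod_cast lt_of_le_of_ne h1 (Ne.symm hne)
    obtain ⟨y, hya, hy⟩ := (Order.coe_lt_height_iff (htop a)).1 hi
    rw [← hfin] at hy
    have hy' : level y = i := by exact_mod_cast hy
    exact absurd (h2 hy'.ge hya.le) (not_le_of_gt hya)

/-- `X` is a compatible listing: it lists every part of `P` exactly once, and vertices `a`, `b` of
different parts satisfy `a < b` exactly when `b` is at least two levels above `a`, or `b` is one
level above `a` and the part of `a` is listed before the part of `b`. -/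
def IsCompatibleListing (X : List (Part P)) : Prop :=
  X.Nodup ∧ (∀ p : Part P, p ∈ X ↔ p.IsPart) ∧
    ∀ i j : Fin X.length, i ≠ j → ∀ a ∈ (X.get i).verts, ∀ b ∈ (X.get j).verts,
      (a < b ↔ level a + 2 ≤ level b ∨ (level a + 1 = level b ∧ i < j))

end Posets

/-- The alphabet. Since levels are numbered from `0` here, `c i` and `t i` are the letters usually
written `c_{i+1}` and `t_{i+1,i+2}`. -/
inductive Letter where
  | c (i : ℕ)
  | t (i : ℕ)

/-- The pairs of letters that commute. -/
def Letter.Commutes : Letter → Letter → Prop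
  | .c i, .c j => i + 2 ≤ j ∨ j + 2 ≤ i
  | .c i, .t j => i + 2 ≤ j ∨ j + 3 ≤ i
  | .t j, .c i => i + 2 ≤ j ∨ j + 3 ≤ i
  | .t i, .t j => i + 3 ≤ j ∨ j + 3 ≤ i

/-- The defining relations `x * y = y * x` of the partially commuting monoid. -/
def commRel (u v : FreeMonoid Letter) : Prop :=
  ∃ x y : Letter, x.Commutes y ∧
    u = FreeMonoid.of x * FreeMonoid.of y ∧ v = FreeMonoid.of y * FreeMonoid.of x

/-- The free partially commuting monoid on the alphabet `Letter`. -/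
abbrev TraceMonoid : Type := PresentedMonoid commRel

/-- The element of the partially commuting monoid represented by a word. -/
def ofWord (w : List Letter) : TraceMonoid := PresentedMonoid.mk commRel (FreeMonoid.ofList w)

/-- A letter, as an element of `ℕ × ℕ` recording the numbers of `c`'s and of `t`'s. -/
def Letter.weight : Letter → Multiplicative (ℕ × ℕ)
  | .c _ => Multiplicative.ofAdd (1, 0)
  | .t _ => Multiplicative.ofAdd (0, 1)

/-- The numbers of letters `c_i` (clone sets) and of letters `t_{i,i+1}` (tangles) in an element
of the partially commuting monoid. -/
def weight : TraceMonoid →* Multiplicative (ℕ × ℕ) :=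
  PresentedMonoid.lift Letter.weight (by
    rintro _ _ ⟨x, y, -, rfl, rfl⟩
    rw [map_mul, map_mul, mul_comm])

/-- The number of clone sets of (a poset with) the skeleton `m`. -/
def numCloneSets (m : TraceMonoid) : ℕ := (weight m).toAdd.1

/-- The number of tangles of (a poset with) the skeleton `m`. -/
def numTangles (m : TraceMonoid) : ℕ := (weight m).toAdd.2

/-- The letter by which a part is replaced: `c i` for a clone set on level `i`, and `t i` for a
tangle with bottom on level `i` and top on level `i + 1`. -/
def HasLetter {P : Type*} [PartialOrder P] : Part P → Letter → Prop
  | .clones C, .c i => ∀ a ∈ C, level a = i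
  | .tangle A B, .t i => (∀ a ∈ A, level a = i + 1) ∧ ∀ b ∈ B, level b = i
  | _, _ => False

/-- `w` is the word of some compatible listing of `P`. -/
def IsListingWord (P : Type*) [PartialOrder P] (w : List Letter) : Prop :=
  ∃ X : List (Part P), IsCompatibleListing X ∧ List.Forall₂ HasLetter X w

/-- `m` is the skeleton of `P`: the words of the compatible listings of `P` are exactly the
representatives of `m`. -/
def IsSkeletonOf (P : Type*) [PartialOrder P] (m : TraceMonoid) : Prop :=
  {w : List Letter | IsListingWord P w} = {w : List Letter | ofWord w = m}

/-- The skeleta of (finite) `(3+1)`-free posets. -/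
def skeleta : Set TraceMonoid :=
  {m | ∃ (P : Type) (_ : PartialOrder P), Finite P ∧ IsThreePlusOneFree P ∧ IsSkeletonOf P m}

/-- The skeleta with `r` clone sets and `s` tangles. -/
def skeletaWith (r s : ℕ) : Set TraceMonoid :=
  {m | m ∈ skeleta ∧ numCloneSets m = r ∧ numTangles m = s}

/-- The generating function `∑ #(skeletaWith r s) c ^ r t ^ s` in `ℚ⟦c, t⟧`, with `c` the variable
`0` and `t` the variable `1`. -/
noncomputable def skeletaSeries : MvPowerSeries (Fin 2) ℚ :=
  fun d => ((skeletaWith (d 0) (d 1)).ncard : ℚ)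

end ThreePlusOne

namespace ThreePlusOne

/-! The proof identifies skeleta with a regular family of words and counts those. Two letters
commute when their level intervals are separated by an empty level, so each element of the monoid
has a unique normal word, in which the next letter starts at most one level above the top of the
current one. Any word of a compatible listing is `Supported` (levels are well founded) and
`Separated` (distinct clone sets are not clones); for normal words this means starting on level 0
without a repeated adjacent `c i`, that is, `Reduced 0`. Conversely, a reduced word `w` is realized
by the explicit poset `Vertex w`, whose only listing words are the representatives of `ofWord w`.

For the count, let R_m be the series of reduced words starting on a level at most m. Removing the
first letter gives R_0 = 1 + κR_1 + tR_2 and R_{m+1} = R_m + κR_{m+2} + tR_{m+3}, where κ = c/(1+c)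
accounts for the ban on repeated `c i`. This system has at most one solution, whence R_m R_n =
R_{m+n+1} (`reducedSeries_mul`). So R_1 and R_2 are the square and cube of R_0, and the first
equation becomes the functional equation. -/

/-- The lowest level occupied by a part with the given letter. -/
def Letter.bot : Letter → ℕ
  | .c i => i
  | .t i => i

/-- The highest level occupied by a part with the given letter. -/
def Letter.top : Letter → ℕ
  | .c i => i
  | .t i => i + 1

theorem Letter.bot_le_top (x : Letter) : x.bot ≤ x.top := by
  cases x <;> simp [Letter.bot, Letter.top]

/-- All the cases of commutation are one condition on level intervals, which `omega` can handle
uniformly. -/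
theorem Letter.commutes_iff (x y : Letter) :
    x.Commutes y ↔ x.top + 2 ≤ y.bot ∨ y.top + 2 ≤ x.bot := by
  cases x <;> cases y <;> simp [Letter.Commutes, Letter.bot, Letter.top]
  omega

theorem Letter.Commutes.symm {x y : Letter} (h : x.Commutes y) : y.Commutes x := by
  rw [Letter.commutes_iff] at *; tauto

/-! ### Words and normal forms -/

theorem ofWord_cons (x : Letter) (u : List Letter) :
    ofWord (x :: u) = ofWord [x] * ofWord u := by
  simp only [ofWord, ← map_mul, ← FreeMonoid.ofList_append]; rfl

theorem ofWord_pair_comm {x y : Letter} (h : x.Commutes y) :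
    ofWord [x] * ofWord [y] = ofWord [y] * ofWord [x] := by
  simp only [ofWord, ← map_mul]
  exact PresentedMonoid.mk_eq_mk_of_rel ⟨x, y, h, rfl, rfl⟩

theorem ofWord_cons_cons_comm {x y : Letter} (h : x.Commutes y) (u : List Letter) :
    ofWord (x :: y :: u) = ofWord (y :: x :: u) := by
  rw [ofWord_cons x (y :: u), ofWord_cons y u, ofWord_cons y (x :: u), ofWord_cons x u,
    ← mul_assoc, ← mul_assoc, ofWord_pair_comm h]

theorem ofWord_surjective : Function.Surjective ofWord := by
  intro m
  induction m using PresentedMonoid.inductionOn with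
  | _ z => exact ⟨FreeMonoid.toList z, rfl⟩

/-- Insert a letter in front of a word, moving it to the right past the letters that commute with
it and lie above it. -/
def Letter.insert (x : Letter) : List Letter → List Letter
  | [] => [x]
  | y :: u => if x.top + 2 ≤ y.bot then y :: x.insert u else x :: y :: u

/-- The higher letter `x` never passes `y`, while `y` passes `x` and everything that `x` passes; so
both orders of insertion put the letters in the same places. This makes insertion an action of the
monoid. -/
theorem Letter.insert_comm_of_above {x y : Letter} (h : y.top + 2 ≤ x.bot) (u : List Letter) :
    x.insert (y.insert u) = y.insert (x.insert u) := by
  have hx := x.bot_le_top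
  have hy := y.bot_le_top
  induction u with
  | nil =>
    have : ¬ x.top + 2 ≤ y.bot := by omega
    simp [Letter.insert, h, this]
  | cons z u ih =>
    have hxy : ¬ x.top + 2 ≤ y.bot := by omega
    by_cases h1 : x.top + 2 ≤ z.bot
    · have h2 : y.top + 2 ≤ z.bot := by omega
      simp [Letter.insert, h1, h2, ih]
    · by_cases h2 : y.top + 2 ≤ z.bot <;> simp [Letter.insert, h, h1, h2, hxy]

theorem Letter.insert_comm {x y : Letter} (h : x.Commutes y) (u : List Letter) :
    x.insert (y.insert u) = y.insert (x.insert u) := by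
  rcases (Letter.commutes_iff x y).1 h with h | h
  · exact (Letter.insert_comm_of_above h u).symm
  · exact Letter.insert_comm_of_above h u

theorem Letter.ofWord_insert (x : Letter) (u : List Letter) :
    ofWord (x.insert u) = ofWord (x :: u) := by
  induction u with
  | nil => rfl
  | cons y u ih =>
    simp only [Letter.insert]
    split_ifs with h
    · rw [ofWord_cons, ih, ← ofWord_cons]
      exact ofWord_cons_cons_comm ((Letter.commutes_iff y x).2 (Or.inr h)) u
    · rfl

/-- The action of the partially commuting monoid on words by insertion of letters. -/
def insertAction : TraceMonoid →* Function.End (List Letter) :=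
  PresentedMonoid.lift (M := Function.End (List Letter)) (fun x => x.insert) (by
    rintro _ _ ⟨x, y, h, rfl, rfl⟩
    rw [map_mul, map_mul]
    funext u
    exact Letter.insert_comm h u)

/-- The normal form of an element of the partially commuting monoid. -/
def normalForm (m : TraceMonoid) : List Letter := insertAction m []

/-- A word is normal when no letter is followed by a commuting letter above it. -/
def Normal (w : List Letter) : Prop := w.IsChain fun x y => y.bot ≤ x.top + 1

theorem normalForm_ofWord_nil : normalForm (ofWord []) = [] := by
  change insertAction 1 [] = []
  rw [map_one]; rfl

theorem normalForm_ofWord_cons (x : Letter) (u : List Letter) :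
    normalForm (ofWord (x :: u)) = x.insert (normalForm (ofWord u)) := by
  rw [ofWord_cons, normalForm, map_mul]
  rfl

/-- The letters passed lie above `x`, so `x` may follow them; the letter where `x` stops may follow
`x` by the stopping condition itself. -/
theorem Normal.insert {u : List Letter} (hu : Normal u) (x : Letter) : Normal (x.insert u) := by
  induction u with
  | nil => simp [Letter.insert, Normal]
  | cons y u ih =>
    simp only [Letter.insert]
    have hx := x.bot_le_top
    have hy := y.bot_le_top
    split_ifs with h
    · cases u with
      | nil => simp only [Letter.insert, Normal, List.isChain_pair]; omega
      | cons z u =>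
        simp only [Normal, List.isChain_cons_cons] at hu ih
        specialize ih hu.2
        simp only [Letter.insert] at ih ⊢
        split_ifs at ih ⊢
        · exact List.isChain_cons_cons.2 ⟨hu.1, ih⟩
        · exact List.isChain_cons_cons.2 ⟨by omega, ih⟩
    · exact List.isChain_cons_cons.2 ⟨by omega, hu⟩

theorem ofWord_normalForm (m : TraceMonoid) : ofWord (normalForm m) = m := by
  obtain ⟨w, rfl⟩ := ofWord_surjective m
  induction w with
  | nil => rw [normalForm_ofWord_nil]
  | cons x u ih =>
    rw [normalForm_ofWord_cons, Letter.ofWord_insert, ofWord_cons, ih, ← ofWord_cons]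

theorem normal_normalForm (m : TraceMonoid) : Normal (normalForm m) := by
  obtain ⟨w, rfl⟩ := ofWord_surjective m
  induction w with
  | nil => rw [normalForm_ofWord_nil]; exact List.isChain_nil
  | cons x u ih => rw [normalForm_ofWord_cons]; exact ih.insert x

/-- In a normal word every insertion stops at once. Hence an element of the monoid has exactly one
normal representative. -/
theorem Normal.normalForm_ofWord {w : List Letter} (hw : Normal w) :
    normalForm (ofWord w) = w := by
  induction w with
  | nil => exact normalForm_ofWord_nil
  | cons x u ih =>
    rw [normalForm_ofWord_cons, ih hw.tail]
    cases u with
    | nil => rfl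
    | cons y u =>
      have := (List.isChain_cons_cons.1 hw).1
      rw [Letter.insert, if_neg (by omega)]

/-! ### Reduced words -/

/-- The letter occupies the level `l`. -/
def Letter.Meets (x : Letter) (l : ℕ) : Prop := x.bot ≤ l ∧ l ≤ x.top

/-- Every letter above level `0` is preceded by a letter that occupies the level just below. -/
def Supported (w : List Letter) : Prop :=
  ∀ (i : ℕ) (hi : i < w.length) (l : ℕ), w[i].bot = l + 1 →
    ∃ (j : ℕ) (hj : j < w.length), j < i ∧ w[j].Meets l

/-- Between two equal letters `c l` there is a letter that occupies a level next to `l`. -/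
def Separated (w : List Letter) : Prop :=
  ∀ (i j : ℕ) (hi : i < w.length) (hj : j < w.length) (l : ℕ), i < j → w[i] = .c l → w[j] = .c l →
    ∃ (k : ℕ) (hk : k < w.length), i < k ∧ k < j ∧
      ∃ l', w[k].Meets l' ∧ (l' + 1 = l ∨ l + 1 = l')

/-- The normal words that start on a level at most `m` and have no two equal consecutive letters
`c i`. -/
def Reduced (m : ℕ) (w : List Letter) : Prop :=
  (∀ x ∈ w.head?, x.bot ≤ m) ∧
    w.IsChain fun x y => y.bot ≤ x.top + 1 ∧ ∀ i, x = .c i → y ≠ .c i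

theorem Reduced.normal {m : ℕ} {w : List Letter} (h : Reduced m w) : Normal w :=
  h.2.imp fun _ _ h => h.1

/-- A discrete intermediate value argument: starting on level 0 and never jumping over a level
upwards, the word visits every level up to the current top. -/
theorem Reduced.supported {w : List Letter} (h : Reduced 0 w) : Supported w := by
  have key : ∀ (i : ℕ) (hi : i < w.length) (l : ℕ), l ≤ w[i].top →
      ∃ (j : ℕ) (hj : j < w.length), j ≤ i ∧ w[j].Meets l := by
    intro i
    induction i with
    | zero =>
      intro hi l hl
      refine ⟨0, hi, le_rfl, ?_, hl⟩
      have := h.1 w[0] (by rw [List.head?_eq_getElem?, List.getElem?_eq_getElem hi]; rfl)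
      omega
    | succ i ih =>
      intro hi l hl
      by_cases hb : w[i + 1].bot ≤ l
      · exact ⟨i + 1, hi, le_rfl, hb, hl⟩
      · have := (List.isChain_iff_getElem.1 h.2 i hi).1
        obtain ⟨j, hj, hji, hm⟩ := ih (by omega) l (by omega)
        exact ⟨j, hj, by omega, hm⟩
  intro i hi l hl
  have := w[i].bot_le_top
  obtain ⟨j, hj, hji, hm⟩ := key i hi l (by omega)
  refine ⟨j, hj, lt_of_le_of_ne hji ?_, hm⟩
  rintro rfl
  have := hm.1
  omega

/-- A `t` occupies two consecutive levels, so it cannot occupy `l` without a neighbour of `l`. -/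
theorem Letter.eq_c_of_not_meets {x : Letter} {l : ℕ}
    (h : ∀ l', x.Meets l' → ¬ (l' + 1 = l ∨ l + 1 = l')) :
    x = .c l ∨ x.top + 2 ≤ l ∨ l + 2 ≤ x.bot := by
  have h1 : ¬ x.Meets (l + 1) := fun hx => h _ hx (Or.inr rfl)
  have h2 : l = 0 ∨ ¬ x.Meets (l - 1) := by
    rcases Nat.eq_zero_or_pos l with hl | hl
    · exact Or.inl hl
    · exact Or.inr fun hx => h _ hx (Or.inl (by omega))
  clear h
  cases x <;> simp only [Letter.Meets, Letter.bot, Letter.top, Letter.c.injEq, reduceCtorEq]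
    at h1 h2 ⊢ <;> omega

theorem Reduced.separated {m : ℕ} {w : List Letter} (h : Reduced m w) : Separated w := by
  intro i j hi hj l hij hci hcj
  by_contra hcon
  push Not at hcon
  -- After the first `c l`, a repeat and an upward jump are both forbidden, so the next letter drops
  -- well below `l`; returning would require meeting level `l - 1`. At `k = j` this is absurd.
  have key : ∀ (k : ℕ) (hk : k < w.length), i < k → k ≤ j → w[k].top + 2 ≤ l := by
    intro k
    induction k with
    | zero => intro _ h; omega
    | succ k ih =>
      intro hk hik hkj
      have hc := List.isChain_iff_getElem.1 h.2 k hk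
      have hb := w[k+1].bot_le_top
      have hcase : w[k+1] = .c l ∨ w[k+1].top + 2 ≤ l ∨ l + 2 ≤ w[k+1].bot := by
        rcases eq_or_lt_of_le hkj with rfl | hlt
        · exact Or.inl hcj
        · exact Letter.eq_c_of_not_meets fun l' hl' => by
            have := hcon (k+1) hk hik hlt l' hl'; tauto
      rcases eq_or_lt_of_le (Nat.lt_succ_iff.1 hik) with rfl | hlt
      · have h2 := hc.2 l hci
        have h1 := hc.1
        simp only [hci, Letter.top] at h1
        rcases hcase with h | h | h
        · exact absurd h h2
        · exact h
        · omega
      · have := ih (by omega) hlt (by omega)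
        rcases hcase with h | h | h
        · have h1 := hc.1
          simp only [h, Letter.bot] at h1
          omega
        · exact h
        · omega
  have := key j hj hij le_rfl
  rw [hcj] at this
  simp only [Letter.top] at this
  omega

/-- Only the extreme cases are needed: support of the first letter, which has no predecessor, and
separation of adjacent letters, which have nothing between them. -/
theorem Normal.reduced {w : List Letter} (h : Normal w) (hs : Supported w) (hc : Separated w) :
    Reduced 0 w := by
  refine ⟨fun x hx => ?_, ?_⟩
  · by_contra hb
    rw [List.head?_eq_getElem?, Option.mem_def, List.getElem?_eq_some_iff] at hx
    obtain ⟨h0, rfl⟩ := hx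
    obtain ⟨j, -, hj, -⟩ := hs 0 h0 (w[0].bot - 1) (by omega)
    omega
  · rw [List.isChain_iff_getElem]
    intro i hi
    refine ⟨List.isChain_iff_getElem.1 h i hi, fun l h1 h2 => ?_⟩
    obtain ⟨k, -, h1, h2, -⟩ := hc i (i + 1) (by omega) hi l (by omega) h1 h2
    omega

/-! ### Generating functions of sets of words -/

/-- The exponent of the monomial in `c, t` contributed by a word. -/
noncomputable def wordWeight : List Letter → (Fin 2 →₀ ℕ)
  | [] => 0
  | .c _ :: w => Finsupp.single 0 1 + wordWeight w
  | .t _ :: w => Finsupp.single 1 1 + wordWeight w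

/-- The generating function of a set of words. -/
noncomputable def wordSeries (S : Set (List Letter)) : MvPowerSeries (Fin 2) ℚ :=
  fun d => ({w ∈ S | wordWeight w = d}.ncard : ℚ)

/-- There are finitely many words of each weight in the set. -/
def FiniteFibers (S : Set (List Letter)) : Prop := ∀ d, {w ∈ S | wordWeight w = d}.Finite

theorem coeff_wordSeries (S : Set (List Letter)) (d : Fin 2 →₀ ℕ) :
    MvPowerSeries.coeff d (wordSeries S) = ({w ∈ S | wordWeight w = d}.ncard : ℚ) := rfl

theorem FiniteFibers.mono {S T : Set (List Letter)} (hT : FiniteFibers T) (h : S ⊆ T) :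
    FiniteFibers S := fun d => (hT d).subset fun _ hw => ⟨h hw.1, hw.2⟩

/-- Finiteness matters here because `ncard` is 0 on infinite sets, where additivity would fail. -/
theorem wordSeries_union {S T : Set (List Letter)} (hS : FiniteFibers S) (hT : FiniteFibers T)
    (h : Disjoint S T) : wordSeries (S ∪ T) = wordSeries S + wordSeries T := by
  ext d
  rw [map_add, coeff_wordSeries, coeff_wordSeries, coeff_wordSeries, ← Nat.cast_add,
    ← Set.ncard_union_eq _ (hS d) (hT d)]
  · congr 2
    ext w
    simp only [Set.mem_union, Set.mem_ofPred_eq]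
    tauto
  · exact h.mono (fun _ hw => hw.1) (fun _ hw => hw.1)

theorem wordSeries_nil : wordSeries {[]} = 1 := by
  classical
  ext d
  rw [coeff_wordSeries, MvPowerSeries.coeff_one]
  split_ifs with h
  · have : {w ∈ ({[]} : Set (List Letter)) | wordWeight w = d} = {[]} := by
      ext w
      simp only [Set.mem_singleton_iff, Set.mem_ofPred_eq, and_iff_left_iff_imp]
      rintro rfl
      rw [h]; rfl
    rw [this, Set.ncard_singleton, Nat.cast_one]
  · have : {w ∈ ({[]} : Set (List Letter)) | wordWeight w = d} = ∅ := by
      ext w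
      simp only [Set.mem_singleton_iff, Set.mem_ofPred_eq, Set.mem_empty_iff_false, iff_false]
      rintro ⟨rfl, hd⟩
      exact h hd.symm
    rw [this, Set.ncard_empty, Nat.cast_zero]

theorem wordSeries_image_cons {x : Letter} {i : Fin 2}
    (hx : ∀ w, wordWeight (x :: w) = Finsupp.single i 1 + wordWeight w) (S : Set (List Letter)) :
    wordSeries ((x :: ·) '' S) = MvPowerSeries.X i * wordSeries S := by
  classical
  ext d
  rw [coeff_wordSeries, MvPowerSeries.X, MvPowerSeries.coeff_monomial_mul, one_mul]
  split_ifs with h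
  · rw [coeff_wordSeries, ← Set.ncard_image_of_injective {w ∈ S | wordWeight w = d - Finsupp.single i 1}
      (List.cons_injective (a := x))]
    congr 2
    ext w
    simp only [Set.mem_image, Set.mem_ofPred_eq]
    constructor
    · rintro ⟨⟨v, hv, rfl⟩, hd⟩
      refine ⟨v, ⟨hv, ?_⟩, rfl⟩
      rw [← hd, hx, add_tsub_cancel_left]
    · rintro ⟨v, ⟨hv, hd⟩, rfl⟩
      refine ⟨⟨v, hv, rfl⟩, ?_⟩
      rw [hx, hd, add_tsub_cancel_of_le h]
  · have : {w ∈ (x :: ·) '' S | wordWeight w = d} = ∅ := by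
      ext w
      simp only [Set.mem_image, Set.mem_ofPred_eq, Set.mem_empty_iff_false, iff_false]
      rintro ⟨⟨v, -, rfl⟩, rfl⟩
      exact h (by rw [hx]; exact le_self_add)
    rw [this, Set.ncard_empty, Nat.cast_zero]

/-! ### Counting reduced words -/

theorem reduced_nil (m : ℕ) : Reduced m [] := ⟨by simp, List.isChain_nil⟩

/-- The bound on the first level is a parameter of `Reduced` so that the tail of a reduced word is
again reduced, with bound one more than the top of the removed letter. -/
theorem reduced_c_cons {m j : ℕ} {w : List Letter} :
    Reduced m (.c j :: w) ↔ j ≤ m ∧ Reduced (j + 1) w ∧ ∀ x ∈ w.head?, x ≠ .c j := by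
  cases w with
  | nil => simp [Reduced, Letter.bot]
  | cons y w =>
    simp only [Reduced, List.isChain_cons_cons, List.head?_cons, Option.mem_def,
      Option.some.injEq, forall_eq', Letter.bot, Letter.top, Letter.c.injEq]
    tauto

theorem reduced_t_cons {m j : ℕ} {w : List Letter} :
    Reduced m (.t j :: w) ↔ j ≤ m ∧ Reduced (j + 2) w := by
  cases w with
  | nil => simp [Reduced, Letter.bot]
  | cons y w =>
    simp only [Reduced, List.isChain_cons_cons, List.head?_cons, Option.mem_def,
      Option.some.injEq, forall_eq', Letter.bot, Letter.top, reduceCtorEq]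
    tauto

theorem degree_wordWeight (w : List Letter) : (wordWeight w).degree = w.length := by
  induction w with
  | nil => simp [wordWeight]
  | cons x w ih => cases x <;> simp [wordWeight, ih, add_comm]

theorem finite_reduced_of_length (n m : ℕ) : {w | Reduced m w ∧ w.length ≤ n}.Finite := by
  induction n generalizing m with
  | zero =>
    refine (Set.finite_singleton []).subset ?_
    rintro w ⟨-, hw⟩
    exact List.eq_nil_of_length_eq_zero (Nat.le_zero.1 hw)
  | succ n ih =>
    refine ((Set.finite_singleton []).union (Set.Finite.biUnion (Set.finite_Iic m) fun j _ =>
      ((ih (j + 1)).image (.c j :: ·)).union ((ih (j + 2)).image (.t j :: ·)))).subset ?_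
    rintro w ⟨hw, hl⟩
    simp only [Set.mem_union, Set.mem_singleton_iff, Set.mem_iUnion, Set.mem_image, Set.mem_Iic,
      Set.mem_ofPred_eq]
    cases w with
    | nil => exact Or.inl rfl
    | cons x w =>
      have hl' : w.length ≤ n := by simpa using hl
      right
      cases x with
      | c j =>
        obtain ⟨hj, hr, -⟩ := reduced_c_cons.1 hw
        exact ⟨j, hj, Or.inl ⟨w, ⟨hr, hl'⟩, rfl⟩⟩
      | t j =>
        obtain ⟨hj, hr⟩ := reduced_t_cons.1 hw
        exact ⟨j, hj, Or.inr ⟨w, ⟨hr, hl'⟩, rfl⟩⟩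

theorem finiteFibers_reduced (m : ℕ) : FiniteFibers {w | Reduced m w} := fun d =>
  (finite_reduced_of_length d.degree m).subset fun w hw => ⟨hw.1, by
    rw [← hw.2, degree_wordWeight]⟩

/-- The words that can follow the letter `c j`. -/
def afterC (j : ℕ) : Set (List Letter) := {w | Reduced (j + 1) w ∧ ∀ x ∈ w.head?, x ≠ .c j}

theorem finiteFibers_afterC (j : ℕ) : FiniteFibers (afterC j) :=
  (finiteFibers_reduced (j + 1)).mono fun _ hw => hw.1

theorem FiniteFibers.image_cons {S : Set (List Letter)} (hS : FiniteFibers S) {x : Letter}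
    {i : Fin 2} (hx : ∀ w, wordWeight (x :: w) = Finsupp.single i 1 + wordWeight w) :
    FiniteFibers ((x :: ·) '' S) := fun d =>
  ((hS (d - Finsupp.single i 1)).image (x :: ·)).subset (by
    rintro _ ⟨⟨v, hv, rfl⟩, rfl⟩
    exact ⟨v, ⟨hv, by rw [hx, add_tsub_cancel_left]⟩, rfl⟩)

theorem wordWeight_c (j : ℕ) (w : List Letter) :
    wordWeight (.c j :: w) = Finsupp.single 0 1 + wordWeight w := rfl

theorem wordWeight_t (j : ℕ) (w : List Letter) :
    wordWeight (.t j :: w) = Finsupp.single 1 1 + wordWeight w := rfl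

/-- The generating function of the reduced words that start on a level at most `m`. -/
noncomputable def reducedSeries (m : ℕ) : MvPowerSeries (Fin 2) ℚ := wordSeries {w | Reduced m w}

open MvPowerSeries (X)

/-- One step of the recursion: the words that start exactly on level `j` are adjoined, and `hj`
makes them new. -/
theorem wordSeries_union_images {S : Set (List Letter)} (hS : FiniteFibers S) (j : ℕ)
    (hj : ∀ w ∈ S, ∀ x ∈ w.head?, x.bot ≠ j) :
    wordSeries (S ∪ ((.c j :: ·) '' afterC j ∪ (.t j :: ·) '' {w | Reduced (j + 2) w})) =
      wordSeries S + X 0 * wordSeries (afterC j) + X 1 * reducedSeries (j + 2) := by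
  have h1 := (finiteFibers_afterC j).image_cons (wordWeight_c j)
  have h2 := (finiteFibers_reduced (j + 2)).image_cons (wordWeight_t j)
  have h12 : Disjoint ((Letter.c j :: ·) '' afterC j)
      ((Letter.t j :: ·) '' {w | Reduced (j + 2) w}) := by
    rw [Set.disjoint_left]
    rintro _ ⟨v, -, rfl⟩ ⟨v', -, h⟩
    simp at h
  rw [wordSeries_union hS, wordSeries_union h1 h2 h12, wordSeries_image_cons (wordWeight_c j),
    wordSeries_image_cons (wordWeight_t j), reducedSeries, add_assoc]
  · intro d
    refine ((h1 d).union (h2 d)).subset ?_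
    rintro w ⟨h | h, hd⟩
    · exact Or.inl ⟨h, hd⟩
    · exact Or.inr ⟨h, hd⟩
  · rw [Set.disjoint_left]
    rintro w hw (⟨v, -, rfl⟩ | ⟨v, -, rfl⟩)
    · exact hj _ hw _ rfl rfl
    · exact hj _ hw _ rfl rfl

theorem reducedSeries_zero :
    reducedSeries 0 = 1 + X 0 * wordSeries (afterC 0) + X 1 * reducedSeries 2 := by
  rw [← wordSeries_nil, ← wordSeries_union_images]
  · rw [reducedSeries]
    congr 1
    ext w
    rcases w with _ | ⟨_ | _, w⟩
    · simp [reduced_nil]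
    · simp only [Set.mem_ofPred_eq, reduced_c_cons, afterC, Set.mem_union, Set.mem_image,
        List.cons.injEq, Letter.c.injEq, Set.mem_singleton_iff, reduceCtorEq, false_and, and_false,
        exists_false, or_false, false_or]
      constructor
      · rintro ⟨h, h'⟩
        obtain rfl := Nat.le_zero.1 h
        exact ⟨w, h', rfl, rfl⟩
      · rintro ⟨_, h, rfl, rfl⟩
        exact ⟨le_rfl, h⟩
    · simp only [Set.mem_ofPred_eq, reduced_t_cons, afterC, Set.mem_union, Set.mem_image,
        List.cons.injEq, Letter.t.injEq, Set.mem_singleton_iff, reduceCtorEq, false_and, and_false,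
        exists_false, false_or]
      constructor
      · rintro ⟨h, h'⟩
        obtain rfl := Nat.le_zero.1 h
        exact ⟨w, h', rfl, rfl⟩
      · rintro ⟨_, h, rfl, rfl⟩
        exact ⟨le_rfl, h⟩
  · exact fun d => (Set.finite_singleton []).subset fun w hw => hw.1
  · rintro w rfl x hx
    simp at hx

theorem reducedSeries_succ (m : ℕ) :
    reducedSeries (m + 1) =
      reducedSeries m + X 0 * wordSeries (afterC (m + 1)) + X 1 * reducedSeries (m + 3) := by
  rw [reducedSeries, reducedSeries, ← wordSeries_union_images (finiteFibers_reduced m)]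
  · congr 1
    ext w
    rcases w with _ | ⟨_ | _, w⟩
    · simp [reduced_nil]
    · simp only [Set.mem_ofPred_eq, reduced_c_cons, afterC, Set.mem_union, Set.mem_image,
        List.cons.injEq, Letter.c.injEq, reduceCtorEq, false_and, and_false,
        exists_false, or_false]
      constructor
      · rintro ⟨h, h'⟩
        rcases Nat.le_succ_iff.1 h with h | rfl
        · exact Or.inl ⟨h, h'⟩
        · exact Or.inr ⟨w, h', rfl, rfl⟩
      · rintro (⟨h, h'⟩ | ⟨_, h, rfl, rfl⟩)
        · exact ⟨by omega, h'⟩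
        · exact ⟨le_rfl, h⟩
    · simp only [Set.mem_ofPred_eq, reduced_t_cons, afterC, Set.mem_union, Set.mem_image,
        List.cons.injEq, Letter.t.injEq, reduceCtorEq, false_and, and_false,
        exists_false, false_or]
      constructor
      · rintro ⟨h, h'⟩
        rcases Nat.le_succ_iff.1 h with h | rfl
        · exact Or.inl ⟨h, h'⟩
        · exact Or.inr ⟨w, h', rfl, rfl⟩
      · rintro (⟨h, h'⟩ | ⟨_, h, rfl, rfl⟩)
        · exact ⟨by omega, h'⟩
        · exact ⟨le_rfl, h⟩
  · rintro w hw x hx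
    have := hw.1 x hx
    omega

/-- A word counted on the left either avoids `c j` as its first letter, or is `c j` followed by a
word that avoids it. Both kinds are enumerated by `afterC j`. -/
theorem reducedSeries_succ_eq_afterC (j : ℕ) :
    reducedSeries (j + 1) = (1 + X 0) * wordSeries (afterC j) := by
  rw [add_mul, one_mul, ← wordSeries_image_cons (wordWeight_c j), reducedSeries,
    ← wordSeries_union (finiteFibers_afterC j) ((finiteFibers_afterC j).image_cons (wordWeight_c j))]
  · congr 1
    ext w
    rcases w with _ | ⟨x, w⟩
    · simp [afterC, reduced_nil]
    · simp only [Set.mem_ofPred_eq, afterC, Set.mem_union, Set.mem_image, List.cons.injEq,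
        List.head?_cons, Option.mem_def, Option.some.injEq, forall_eq']
      constructor
      · intro h
        by_cases hx : x = .c j
        · subst hx
          exact Or.inr ⟨w, (reduced_c_cons.1 h).2, rfl, rfl⟩
        · exact Or.inl ⟨h, hx⟩
      · rintro (h | ⟨_, h, rfl, rfl⟩)
        · exact h.1
        · exact reduced_c_cons.2 ⟨by omega, h⟩
  · rw [Set.disjoint_left]
    rintro _ hw ⟨v, -, rfl⟩
    exact hw.2 _ rfl rfl

/-! ### The linear system and the functional equation -/

/-- The weight `c / (1 + c)` of a clone set in the functional equation. -/
noncomputable def cloneFactor : MvPowerSeries (Fin 2) ℚ := X 0 * (1 + X 0)⁻¹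

theorem X_mul_wordSeries_afterC (j : ℕ) :
    X 0 * wordSeries (afterC j) = cloneFactor * reducedSeries (j + 1) := by
  rw [reducedSeries_succ_eq_afterC, cloneFactor, mul_assoc, ← mul_assoc _⁻¹,
    MvPowerSeries.inv_mul_cancel _ (by simp), one_mul]

theorem one_le_order_cloneFactor : 1 ≤ cloneFactor.order := by
  rw [MvPowerSeries.one_le_order_iff_constCoeff_eq_zero]
  simp [cloneFactor]

theorem one_le_order_X_one : 1 ≤ (X 1 : MvPowerSeries (Fin 2) ℚ).order := by
  rw [MvPowerSeries.one_le_order_iff_constCoeff_eq_zero]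
  simp

/-- The linear system satisfied by the series `reducedSeries m` has at most one solution. -/
theorem eq_zero_of_linear_system {D : ℕ → MvPowerSeries (Fin 2) ℚ}
    (h0 : D 0 = cloneFactor * D 1 + X 1 * D 2)
    (hsucc : ∀ m, D (m + 1) = D m + (cloneFactor * D (m + 2) + X 1 * D (m + 3))) (m : ℕ) :
    D m = 0 := by
  -- Both coefficients have order at least 1, so a bound on all orders improves by one in the
  -- correction terms; the induction on `m` below carries the improvement from `D 0` to every `D m`.
  have step : ∀ n : ℕ, (∀ m, (n : ℕ∞) ≤ (D m).order) →
      ∀ m m', ((n + 1 : ℕ) : ℕ∞) ≤ (cloneFactor * D m + X 1 * D m').order := by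
    intro n hn m m'
    refine le_trans (le_min ?_ ?_) MvPowerSeries.min_order_le_add
    · refine le_trans ?_ MvPowerSeries.le_order_mul
      push_cast
      rw [add_comm]
      exact add_le_add one_le_order_cloneFactor (hn m)
    · refine le_trans ?_ MvPowerSeries.le_order_mul
      push_cast
      rw [add_comm]
      exact add_le_add one_le_order_X_one (hn m')
  have key : ∀ n : ℕ, ∀ m, (n : ℕ∞) ≤ (D m).order := by
    intro n
    induction n with
    | zero => simp
    | succ n ih =>
      intro m
      induction m with
      | zero => rw [h0]; exact step n ih 1 2
      | succ m ihm =>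
        rw [hsucc]
        exact le_trans (le_min ihm (step n ih _ _)) MvPowerSeries.min_order_le_add
  rw [← MvPowerSeries.order_eq_top_iff]
  exact ENat.eq_top_iff_forall_ge.2 fun n => key n m

/-- With `n` fixed, both sides satisfy the same linear recursion in `m`. In the equation for `m = 0`
the inhomogeneous term is `reducedSeries n` on both sides, so the difference solves the homogeneous
system and vanishes. -/
theorem reducedSeries_mul (m n : ℕ) :
    reducedSeries m * reducedSeries n = reducedSeries (m + n + 1) := by
  rw [← sub_eq_zero]
  refine eq_zero_of_linear_system
    (D := fun m => reducedSeries m * reducedSeries n - reducedSeries (m + n + 1)) ?_ ?_ m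
  · have h1 := reducedSeries_zero
    have h2 := reducedSeries_succ n
    rw [X_mul_wordSeries_afterC] at h1 h2
    simp only [zero_add] at h1 ⊢
    rw [show 1 + n + 1 = n + 1 + 1 by ring, show 2 + n + 1 = n + 3 by ring, h2]
    nth_rw 1 [h1]
    ring
  · intro m
    have h1 := reducedSeries_succ m
    have h2 := reducedSeries_succ (m + n + 1)
    rw [X_mul_wordSeries_afterC] at h1 h2
    rw [show m + 1 + n + 1 = m + n + 1 + 1 by ring, show m + 2 + n + 1 = m + n + 1 + 1 + 1 by ring,
      show m + 3 + n + 1 = m + n + 1 + 3 by ring, h2, h1]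
    ring

theorem reducedSeries_zero_eq :
    reducedSeries 0 =
      1 + X 0 * (1 + X 0)⁻¹ * reducedSeries 0 ^ 2 + X 1 * reducedSeries 0 ^ 3 := by
  have h1 : reducedSeries 0 ^ 2 = reducedSeries 1 := by rw [sq, reducedSeries_mul]
  have h2 : reducedSeries 0 ^ 3 = reducedSeries 2 := by rw [pow_succ, h1, reducedSeries_mul]
  rw [h1, h2]
  change _ = 1 + cloneFactor * _ + _
  rw [← X_mul_wordSeries_afterC]
  exact reducedSeries_zero

theorem eq_of_functional_equation {F G : MvPowerSeries (Fin 2) ℚ}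
    (hF : F = 1 + X 0 * (1 + X 0)⁻¹ * F ^ 2 + X 1 * F ^ 3)
    (hG : G = 1 + X 0 * (1 + X 0)⁻¹ * G ^ 2 + X 1 * G ^ 3) : F = G := by
  -- The divided difference of the right-hand side. Its constant term is 0, so `1 - N` is nonzero in
  -- a domain.
  set N := X 0 * (1 + X 0)⁻¹ * (F + G) + X 1 * (F ^ 2 + F * G + G ^ 2) with hN
  have h : (F - G) * (1 - N) = 0 := by
    rw [hN]
    linear_combination hF - hG
  rcases mul_eq_zero.1 h with h | h
  · exact sub_eq_zero.1 h
  · have := congrArg MvPowerSeries.constantCoeff h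
    simp [hN] at this

section Listings

variable {P : Type*} [PartialOrder P]

/-! ### Levels -/

theorem height_lt_top [Finite P] (a : P) : Order.height a < ⊤ := by
  have := Fintype.ofFinite P
  refine lt_of_le_of_lt (b := ((Fintype.card P : ℕ) : ℕ∞)) ?_ (ENat.natCast_lt_top _)
  refine Order.height_le fun p _ => ?_
  exact_mod_cast p.length_lt_card.le

theorem natCast_level [Finite P] (a : P) : ((level a : ℕ) : ℕ∞) = Order.height a :=
  ENat.natCast_toNat (ne_of_lt (height_lt_top a))

theorem level_lt_level [Finite P] {a b : P} (h : a < b) : level a < level b := by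
  have h := Order.height_strictMono h (height_lt_top a)
  rw [← natCast_level, ← natCast_level] at h
  exact_mod_cast h

theorem exists_lt_level_eq [Finite P] {a : P} {i : ℕ} (h : i < level a) :
    ∃ b < a, level b = i := by
  have h : (i : ℕ∞) < Order.height a := by
    rw [← natCast_level]; exact_mod_cast h
  obtain ⟨b, hb, hi⟩ := (Order.coe_lt_height_iff (height_lt_top a)).1 h
  rw [← natCast_level] at hi
  exact ⟨b, hb, by exact_mod_cast hi⟩

/-- The level is the only rank function under which every vertex of positive rank lies above
a vertex whose rank is smaller by one. -/
theorem level_eq_of_rank [Finite P] {f : P → ℕ} (hlt : ∀ a b, a < b → f a < f b)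
    (hex : ∀ a i, f a = i + 1 → ∃ b < a, f b = i) (a : P) : level a = f a := by
  have hle : ∀ n a, f a = n → n ≤ level a := by
    intro n
    induction n with
    | zero => intro a _; exact Nat.zero_le _
    | succ n ih =>
      intro a ha
      obtain ⟨b, hb, hn⟩ := hex a n ha
      have := ih b hn
      have := level_lt_level hb
      omega
  have hge : ∀ n a, level a = n → n ≤ f a := by
    intro n
    induction n with
    | zero => intro a _; exact Nat.zero_le _
    | succ n ih =>
      intro a ha
      obtain ⟨b, hb, hn⟩ := exists_lt_level_eq (a := a) (i := n) (by omega)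
      have := ih b hn
      have := hlt b a hb
      omega
  exact le_antisymm (hge _ a rfl) (hle _ a rfl)

/-! ### Parts and listings -/

theorem exists_isPart_mem (a : P) : ∃ p : Part P, p.IsPart ∧ a ∈ p.verts := by
  by_cases h : a ∈ untangled P
  · exact ⟨.clones {b | b ∈ untangled P ∧ IsClone a b}, ⟨a, h, rfl⟩, h, rfl⟩
  · obtain ⟨A, B, hAB, ha⟩ := not_not.1 h
    exact ⟨.tangle A B, hAB, ha⟩

theorem HasLetter.meets {p : Part P} {x : Letter} (h : HasLetter p x) {a : P}
    (ha : a ∈ p.verts) : x.Meets (level a) := by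
  cases p <;> cases x <;> simp only [HasLetter, Part.verts] at h ha
  · have := h a ha
    simp [Letter.Meets, Letter.bot, Letter.top, this]
  · rcases ha with ha | ha
    · have := h.1 a ha
      simp [Letter.Meets, Letter.bot, Letter.top, this]
    · have := h.2 a ha
      simp [Letter.Meets, Letter.bot, Letter.top, this]

theorem HasLetter.exists_level_eq_bot {p : Part P} {x : Letter} (h : HasLetter p x)
    (hp : p.IsPart) : ∃ a ∈ p.verts, level a = x.bot := by
  cases p <;> cases x <;> simp only [HasLetter, Part.IsPart] at h hp
  · obtain ⟨a, ha, rfl⟩ := hp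
    exact ⟨a, ⟨ha, rfl⟩, h a ⟨ha, rfl⟩⟩
  · obtain ⟨b, hb⟩ := hp.2.1.1.nonempty
    exact ⟨b, Or.inr hb, h.2 b hb⟩

/-- The condition on the vertices of two parts of a compatible listing, the first of which is
listed before the second. -/
def ListedBefore (p q : Part P) : Prop :=
  ∀ a ∈ p.verts, ∀ b ∈ q.verts,
    (a < b ↔ level a + 1 ≤ level b) ∧ (b < a ↔ level b + 2 ≤ level a)

/-- Once it is known which part comes first, a gap of one level suffices in the forward direction
and a gap of two is needed backwards. -/
theorem isCompatibleListing_iff {X : List (Part P)} :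
    IsCompatibleListing X ↔
      X.Nodup ∧ (∀ p : Part P, p ∈ X ↔ p.IsPart) ∧ X.Pairwise ListedBefore := by
  unfold IsCompatibleListing
  refine and_congr_right fun _ => and_congr_right fun _ => ?_
  rw [List.pairwise_iff_get]
  constructor
  · intro h i j hij a ha b hb
    rw [h i j hij.ne a ha b hb, h j i hij.ne' b hb a ha]
    have := hij.not_gt
    constructor
    · simp only [hij, and_true]; omega
    · simp only [this, and_false, or_false]
  · intro h i j hij a ha b hb
    rcases lt_or_gt_of_ne hij with hij | hij
    · rw [(h i j hij a ha b hb).1]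
      simp only [hij, and_true]; omega
    · rw [(h j i hij b hb a ha).2]
      have := hij.not_gt
      simp only [this, and_false, or_false]

/-- Vertices of commuting parts are at least two levels apart, where the order of listing is
irrelevant. -/
theorem ListedBefore.of_commutes {p q : Part P} {x y : Letter} (h : ListedBefore p q)
    (hp : HasLetter p x) (hq : HasLetter q y) (hxy : x.Commutes y) : ListedBefore q p := by
  intro b hb a ha
  have h1 := hp.meets ha
  have h2 := hq.meets hb
  rw [Letter.commutes_iff] at hxy
  unfold Letter.Meets at h1 h2
  obtain ⟨h3, h4⟩ := h a ha b hb
  rw [h3, h4]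
  omega

theorem IsListingWord.swap {x y : Letter} (hxy : x.Commutes y) {u v : List Letter}
    (h : IsListingWord P (u ++ x :: y :: v)) : IsListingWord P (u ++ y :: x :: v) := by
  obtain ⟨X, hX, hw⟩ := h
  have hu := List.forall₂_take_append X u _ hw
  have hv := List.forall₂_drop_append X u _ hw
  rw [List.forall₂_cons_right_iff] at hv
  obtain ⟨p, Y, hp, hv, hY⟩ := hv
  rw [List.forall₂_cons_right_iff] at hv
  obtain ⟨q, Z, hq, hv, rfl⟩ := hv
  rw [← List.take_append_drop u.length X, hY] at hX
  rw [isCompatibleListing_iff] at hX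
  refine ⟨X.take u.length ++ q :: p :: Z, isCompatibleListing_iff.2 ?_,
    List.rel_append hu (.cons hq (.cons hp hv))⟩
  have hperm : (X.take u.length ++ p :: q :: Z).Perm (X.take u.length ++ q :: p :: Z) :=
    List.Perm.append_left _ (List.Perm.swap _ _ _)
  refine ⟨hperm.nodup_iff.1 hX.1, fun r => by rw [← hperm.mem_iff, hX.2.1], ?_⟩
  have h3 := hX.2.2
  simp only [List.pairwise_append, List.pairwise_cons, List.mem_cons, forall_eq_or_imp] at h3 ⊢
  obtain ⟨h3, ⟨⟨h4, h5⟩, h6, h7⟩, h8⟩ := h3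
  exact ⟨h3, ⟨⟨h4.of_commutes hp hq hxy, h6⟩, h5, h7⟩,
    fun a ha => ⟨(h8 a ha).2.1, (h8 a ha).1, (h8 a ha).2.2⟩⟩

/-- The surrounding words `s` and `t` are what the induction needs to treat products in the
generated congruence. -/
theorem isListingWord_iff_of_conGen {u v : FreeMonoid Letter} (h : ConGen.Rel commRel u v)
    (s t : List Letter) :
    IsListingWord P (s ++ u.toList ++ t) ↔ IsListingWord P (s ++ v.toList ++ t) := by
  induction h generalizing s t with
  | of u v h =>
    obtain ⟨x, y, hxy, rfl, rfl⟩ := h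
    simp only [FreeMonoid.toList_mul, FreeMonoid.toList_of, List.append_assoc,
      List.cons_append, List.nil_append]
    exact ⟨IsListingWord.swap hxy, IsListingWord.swap hxy.symm⟩
  | refl => exact Iff.rfl
  | symm _ ih => exact (ih s t).symm
  | trans _ _ ih1 ih2 => exact (ih1 s t).trans (ih2 s t)
  | @mul u u' v v' _ _ ih1 ih2 =>
    simp only [FreeMonoid.toList_mul]
    have h1 := ih1 s (v.toList ++ t)
    have h2 := ih2 (s ++ u'.toList) t
    simp only [List.append_assoc] at h1 h2 ⊢
    exact h1.trans h2

theorem isListingWord_iff_of_ofWord_eq {u v : List Letter} (h : ofWord u = ofWord v) :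
    IsListingWord P u ↔ IsListingWord P v := by
  have := isListingWord_iff_of_conGen (P := P) (PresentedMonoid.mk_eq_mk_iff.1 h) [] []
  simpa using this

/-! ### Words of compatible listings -/

/-- A vertex on the lowest level `l + 1` of a part lies above some vertex on level `l`. That vertex
is too low for the same part, and a later part would need a gap of two levels. -/
theorem IsListingWord.supported [Finite P] {w : List Letter} (h : IsListingWord P w) :
    Supported w := by
  obtain ⟨X, hX, hw⟩ := h
  obtain ⟨-, hmem, hpw⟩ := isCompatibleListing_iff.1 hX
  rw [List.pairwise_iff_getElem] at hpw
  obtain ⟨hlen, hget⟩ := List.forall₂_iff_get.1 hw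
  intro i hi l hl
  have hiX : i < X.length := hlen ▸ hi
  have hxi : HasLetter X[i] w[i] := hget i hiX hi
  obtain ⟨a, ha, hla⟩ := hxi.exists_level_eq_bot ((hmem _).1 (List.getElem_mem hiX))
  obtain ⟨b, hb, hlb⟩ := exists_lt_level_eq (a := a) (i := l) (by omega)
  obtain ⟨q, hq, hbq⟩ := exists_isPart_mem b
  obtain ⟨j, hjX, rfl⟩ := List.mem_iff_getElem.1 ((hmem q).2 hq)
  have hj : j < w.length := hlen ▸ hjX
  have hxj : HasLetter X[j] w[j] := hget j hjX hj
  refine ⟨j, hj, ?_, hlb ▸ hxj.meets hbq⟩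
  by_contra hij
  rcases eq_or_lt_of_le (not_lt.1 hij) with rfl | hij
  · have := (hxj.meets hbq).1
    omega
  · have := ((hpw i j hiX hjX hij) a ha b hbq).2.1 hb
    omega

/-- Otherwise vertices of the two clone sets have the same view, so the clone sets coincide,
although a listing has no repetition. -/
theorem IsListingWord.separated [Finite P] {w : List Letter} (h : IsListingWord P w) :
    Separated w := by
  obtain ⟨X, hX, hw⟩ := h
  obtain ⟨hnd, hmem, hpw⟩ := isCompatibleListing_iff.1 hX
  rw [List.pairwise_iff_getElem] at hpw
  obtain ⟨hlen, hget⟩ := List.forall₂_iff_get.1 hw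
  intro i j hi hj l hij hci hcj
  by_contra hcon
  push Not at hcon
  have hiX : i < X.length := hlen ▸ hi
  have hjX : j < X.length := hlen ▸ hj
  have hxi : HasLetter X[i] w[i] := hget i hiX hi
  have hxj : HasLetter X[j] w[j] := hget j hjX hj
  have hpi := (hmem _).1 (List.getElem_mem hiX)
  have hpj := (hmem _).1 (List.getElem_mem hjX)
  obtain ⟨a, ha, hla⟩ := hxi.exists_level_eq_bot hpi
  obtain ⟨b, hb, hlb⟩ := hxj.exists_level_eq_bot hpj
  rw [hci, Letter.bot] at hla
  rw [hcj, Letter.bot] at hlb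
  -- A part listed before both or after both treats `a` and `b` alike; one listed between them
  -- contributes no level next to `l`, so its place does not matter; the two clone sets themselves
  -- lie on level `l`.
  have hview : ∀ z, (z < a ↔ z < b) ∧ (a < z ↔ b < z) := by
    intro z
    obtain ⟨q, hq, hz⟩ := exists_isPart_mem z
    obtain ⟨k, hkX, rfl⟩ := List.mem_iff_getElem.1 ((hmem q).2 hq)
    have hk : k < w.length := hlen ▸ hkX
    have hxk : HasLetter X[k] w[k] := hget k hkX hk
    have hmz := hxk.meets hz
    have hself : level z = l → (z < a ↔ z < b) ∧ (a < z ↔ b < z) := by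
      intro hlz
      refine ⟨iff_of_false ?_ ?_, iff_of_false ?_ ?_⟩ <;> intro h <;>
        have := level_lt_level h <;> omega
    rcases lt_trichotomy k i with hki | rfl | hki
    · have h1 := hpw k i hkX hiX hki z hz a ha
      have h2 := hpw k j hkX hjX (hki.trans hij) z hz b hb
      rw [h1.1, h1.2, h2.1, h2.2]
      omega
    · rw [hci] at hmz
      simp only [Letter.Meets, Letter.bot, Letter.top] at hmz
      exact hself (by omega)
    · have h1 := hpw i k hiX hkX hki a ha z hz
      rcases lt_trichotomy k j with hkj | rfl | hkj
      · have h2 := hpw k j hkX hjX hkj z hz b hb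
        have h3 := hcon k hk hki hkj _ hmz
        rw [h1.1, h1.2, h2.1, h2.2]
        omega
      · rw [hcj] at hmz
        simp only [Letter.Meets, Letter.bot, Letter.top] at hmz
        exact hself (by omega)
      · have h2 := hpw j k hjX hkX hkj b hb z hz
        rw [h1.1, h1.2, h2.1, h2.2]
        omega
  have hab : view a = view b := by
    refine Prod.ext (Set.ext fun z => (hview z).1) (compl_inj_iff.2 (Set.ext fun z => (hview z).2))
  refine hij.ne ((List.Nodup.getElem_inj_iff hnd).1 (?_ : X[i] = X[j]))
  generalize X[i] = p at *
  generalize X[j] = q at *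
  rw [hci] at hxi
  rw [hcj] at hxj
  cases p with
  | tangle => exact hxi.elim
  | clones C =>
    cases q with
    | tangle => exact hxj.elim
    | clones C' =>
      obtain ⟨a', -, rfl⟩ := hpi
      obtain ⟨b', -, rfl⟩ := hpj
      have h1 : view a' = view a := ha.2
      have h2 : view b' = view b := hb.2
      simp only [IsClone, h1, h2, hab]

end Listings

/-- Every representative of a skeleton is a listing word, in particular the normal one. -/
theorem Reduced.of_mem_skeleta {m : TraceMonoid} (h : m ∈ skeleta) : Reduced 0 (normalForm m) := by
  obtain ⟨P, _, _, -, hm⟩ := h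
  have hw : IsListingWord P (normalForm m) := by
    change normalForm m ∈ {w | IsListingWord P w}
    rw [hm]
    exact ofWord_normalForm m
  exact (normal_normalForm m).reduced hw.supported hw.separated

/-! ### The poset of a word -/

/-- The vertices of the poset of a word: one for each letter `c i`, and four for each letter `t i`,
two of them in the bottom and two of them in the top of a tangle. -/
structure Vertex (w : List Letter) where
  /-- The position of the letter in the word. -/
  pos : Fin w.length
  /-- Whether the vertex is in the top of a tangle. -/
  upper : Bool
  /-- The chain of the tangle in which the vertex lies. -/
  side : Bool
  eq_false_of_c : ∀ i, w.get pos = .c i → upper = false ∧ side = false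

namespace Vertex

variable {w : List Letter}

theorem ext {a b : Vertex w} (h1 : a.pos = b.pos) (h2 : a.upper = b.upper)
    (h3 : a.side = b.side) : a = b := by
  cases a; cases b; cases h1; cases h2; cases h3; rfl

instance : Finite (Vertex w) :=
  Finite.of_injective (fun a : Vertex w => (a.pos, a.upper, a.side)) fun a b h => by
    simp only [Prod.mk.injEq] at h
    exact ext h.1 h.2.1 h.2.2

/-- The level of a vertex, read off from its letter. -/
def rank (a : Vertex w) : ℕ := (w.get a.pos).bot + a.upper.toNat

/-- Between different letters this is the order forced by compatibility; `side` matters only inside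
a tangle, which becomes two disjoint chains. Transitivity is automatic, since two strict steps raise
the rank by at least 2. -/
instance : PartialOrder (Vertex w) where
  le a b := a = b ∨ a.rank + 2 ≤ b.rank ∨
    a.rank + 1 = b.rank ∧ (a.pos.val < b.pos.val ∨ a.pos.val = b.pos.val ∧ a.side = b.side)
  lt a b := a.rank + 2 ≤ b.rank ∨
    a.rank + 1 = b.rank ∧ (a.pos.val < b.pos.val ∨ a.pos.val = b.pos.val ∧ a.side = b.side)
  le_refl a := Or.inl rfl
  le_trans a b c := by
    rintro (rfl | h1) (rfl | h2)
    · exact Or.inl rfl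
    · exact Or.inr h2
    · exact Or.inr h1
    · exact Or.inr (Or.inl (by omega))
  lt_iff_le_not_ge a b := by
    constructor
    · intro h
      refine ⟨Or.inr h, ?_⟩
      rintro (rfl | h') <;> omega
    · rintro ⟨rfl | h, h'⟩
      · exact absurd (Or.inl rfl) h'
      · exact h
  le_antisymm a b := by
    rintro (rfl | h1) (h | h2)
    · rfl
    · rfl
    · exact h.symm
    · omega

theorem lt_iff {a b : Vertex w} : a < b ↔ a.rank + 2 ≤ b.rank ∨
    a.rank + 1 = b.rank ∧ (a.pos.val < b.pos.val ∨ a.pos.val = b.pos.val ∧ a.side = b.side) :=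
  Iff.rfl

theorem rank_eq_of_pos_eq {a b : Vertex w} (h : a.pos = b.pos) (hu : a.upper = b.upper) :
    a.rank = b.rank := by
  rw [rank, rank, h, hu]

theorem rank_le_rank_add_one {a b : Vertex w} (h : a.pos.val = b.pos.val) :
    b.rank ≤ a.rank + 1 := by
  rw [rank, rank, Fin.ext h]
  have := b.upper.toNat_le
  omega

theorem lt_iff_of_pos_eq {a b : Vertex w} (h : a.pos = b.pos) :
    a < b ↔ a.upper = false ∧ b.upper = true ∧ a.side = b.side := by
  rw [lt_iff, rank, rank, h]
  cases a.upper <;> cases b.upper <;> simp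
  grind

theorem rank_of_c {a : Vertex w} {i : ℕ} (h : w.get a.pos = .c i) : a.rank = i := by
  rw [rank, h, (a.eq_false_of_c i h).1]; rfl

theorem rank_of_t {a : Vertex w} {i : ℕ} (h : w.get a.pos = .t i) :
    a.rank = i + a.upper.toNat := by
  rw [rank, h]; rfl

theorem exists_of_meets {k : Fin w.length} {l : ℕ} (h : (w.get k).Meets l) :
    ∃ a : Vertex w, a.pos = k ∧ a.rank = l := by
  cases hk : w.get k with
  | c i =>
    refine ⟨⟨k, false, false, fun _ _ => ⟨rfl, rfl⟩⟩, rfl, ?_⟩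
    rw [hk] at h
    simp only [Letter.Meets, Letter.bot, Letter.top] at h
    simp only [rank, hk, Letter.bot, Bool.toNat_false]
    omega
  | t i =>
    rw [hk] at h
    simp only [Letter.Meets, Letter.bot, Letter.top] at h
    refine ⟨⟨k, decide (l = i + 1), false, fun j hj => ?_⟩, rfl, ?_⟩
    · rw [hk] at hj; cases hj
    · simp only [rank, hk, Letter.bot]
      by_cases hl : l = i + 1
      · simp [hl]
      · simp [hl]; omega

/-- Ranks force `d` to lie one above `a` and one below `c`. Then the position of `c` is at most that
of `d`, which is at most that of `a`, while the chain gives the reverse inequality; so `a` and `c`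
share a letter, which spans at most two ranks. -/
theorem isThreePlusOneFree : IsThreePlusOneFree (Vertex w) := by
  rintro ⟨a, b, c, d, hab, hbc, ⟨-, hda⟩, -, ⟨hdc, -⟩⟩
  have h1 : ¬ a < d := fun h => hda h.le
  have h2 : ¬ d < c := fun h => hdc h.le
  rw [lt_iff] at *
  have h3 := rank_le_rank_add_one (a := a) (b := c)
  omega

/-- A top vertex has its partner on the same side below it; any other vertex of positive rank has
one below it by support. -/
theorem level_eq_rank (hw : Supported w) (a : Vertex w) : level a = a.rank := by
  refine level_eq_of_rank (f := rank) (fun a b h => ?_) (fun a i h => ?_) a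
  · rw [lt_iff] at h; omega
  · cases hu : a.upper with
    | true =>
      let b : Vertex w := ⟨a.pos, false, a.side, fun j hj => by
        simp [(a.eq_false_of_c j hj).1] at hu⟩
      exact ⟨b, (lt_iff_of_pos_eq (a := b) (b := a) rfl).2 ⟨rfl, hu, rfl⟩, by
        rw [rank, hu] at h; exact Nat.succ.inj h⟩
    | false =>
      have hb : w[a.pos.val].bot = i + 1 := by simpa [rank, hu] using h
      obtain ⟨j, hj, hlt, hm⟩ := hw a.pos.val a.pos.isLt i hb
      obtain ⟨b, hb, hr⟩ := exists_of_meets (k := ⟨j, hj⟩) hm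
      refine ⟨b, lt_iff.2 (Or.inr ⟨by omega, Or.inl ?_⟩), hr⟩
      rw [hb]
      exact hlt

/-! ### Tangles and clone sets of the poset of a word -/

/-- Views are nested along the lexicographic order of rank and position, so edges of the two tangle
graphs can only join vertices of one letter on one level. -/
theorem Iio_subset_and_Ioi_subset {a b : Vertex w}
    (h : a.rank < b.rank ∨ a.rank = b.rank ∧ a.pos.val < b.pos.val) :
    Set.Iio a ⊆ Set.Iio b ∧ Set.Ioi b ⊆ Set.Ioi a := by
  constructor <;> intro x hx
  · rw [Set.mem_Iio, lt_iff] at *; omega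
  · rw [Set.mem_Ioi, lt_iff] at *; omega

theorem pos_and_rank_eq_of_adj {a b : Vertex w}
    (h : (topGraph (Vertex w)).Adj a b ∨ (botGraph (Vertex w)).Adj a b) :
    a.pos = b.pos ∧ a.rank = b.rank := by
  have h1 := Iio_subset_and_Ioi_subset (a := a) (b := b)
  have h2 := Iio_subset_and_Ioi_subset (a := b) (b := a)
  have h3 : ¬ (a.rank < b.rank ∨ a.rank = b.rank ∧ a.pos.val < b.pos.val) := fun h' =>
    h.elim (fun h => h.1 (h1 h').1) fun h => h.2 (h1 h').2
  have h4 : ¬ (b.rank < a.rank ∨ b.rank = a.rank ∧ b.pos.val < a.pos.val) := fun h' =>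
    h.elim (fun h => h.2 (h2 h').1) fun h => h.1 (h2 h').2
  exact ⟨Fin.ext (by omega), by omega⟩

theorem upper_eq_of_pos_and_rank_eq {a b : Vertex w} (h : a.pos = b.pos ∧ a.rank = b.rank) :
    a.upper = b.upper := by
  have h2 := h.2
  rw [rank, rank, h.1, Nat.add_left_cancel_iff] at h2
  revert h2
  cases a.upper <;> cases b.upper <;> simp

theorem Iio_subset_of_lower {a b : Vertex w} (h : a.pos = b.pos ∧ a.rank = b.rank)
    (ha : a.upper = false) : Set.Iio a ⊆ Set.Iio b := by
  intro x hx
  have h1 := congrArg Fin.val h.1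
  by_cases hxa : x.pos = a.pos
  · simpa [ha] using (lt_iff_of_pos_eq hxa).1 hx
  · have := Fin.val_ne_of_ne hxa
    rw [Set.mem_Iio, lt_iff] at *
    omega

theorem Ioi_subset_of_upper {a b : Vertex w} (h : a.pos = b.pos ∧ a.rank = b.rank)
    (ha : a.upper = true) : Set.Ioi a ⊆ Set.Ioi b := by
  intro x hx
  have h1 := congrArg Fin.val h.1
  by_cases hxa : a.pos = x.pos
  · simpa [ha] using (lt_iff_of_pos_eq hxa).1 hx
  · have := Fin.val_ne_of_ne hxa
    rw [Set.mem_Ioi, lt_iff] at *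
    omega

theorem ne_c_of_ne {a b : Vertex w} (h : a ≠ b) (hp : a.pos = b.pos) (i : ℕ) :
    w.get a.pos ≠ .c i := fun hc => by
  have h1 := a.eq_false_of_c i hc
  have h2 := b.eq_false_of_c i (hp ▸ hc)
  exact h (ext hp (h1.1.trans h2.1.symm) (h1.2.trans h2.2.symm))

theorem topGraph_adj {a b : Vertex w} : (topGraph (Vertex w)).Adj a b ↔
    a ≠ b ∧ a.upper = true ∧ b.upper = true ∧ a.pos = b.pos := by
  constructor
  · intro h
    have h1 := pos_and_rank_eq_of_adj (Or.inl h)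
    have hu := upper_eq_of_pos_and_rank_eq h1
    have ha : a.upper = true := by
      by_contra hf
      exact h.1 (Iio_subset_of_lower h1 (by simpa using hf))
    exact ⟨h.ne, ha, hu ▸ ha, h1.1⟩
  · have key : ∀ {a b : Vertex w}, a ≠ b → a.upper = true → b.upper = true → a.pos = b.pos →
        ¬ Set.Iio a ⊆ Set.Iio b := by
      intro a b hne ha hb hp hsub
      -- The partner of `a` in its chain lies below `a` but not below `b`.
      let c : Vertex w := ⟨a.pos, false, a.side, fun i hi => absurd hi (ne_c_of_ne hne hp i)⟩
      have hc : c ∈ Set.Iio a := (lt_iff_of_pos_eq (a := c) (b := a) rfl).2 ⟨rfl, ha, rfl⟩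
      exact hne (ext hp (ha.trans hb.symm) ((lt_iff_of_pos_eq (a := c) hp).1 (hsub hc)).2.2)
    rintro ⟨hne, ha, hb, hp⟩
    exact ⟨key hne ha hb hp, key hne.symm hb ha hp.symm⟩

theorem botGraph_adj {a b : Vertex w} : (botGraph (Vertex w)).Adj a b ↔
    a ≠ b ∧ a.upper = false ∧ b.upper = false ∧ a.pos = b.pos := by
  constructor
  · intro h
    have h1 := pos_and_rank_eq_of_adj (Or.inr h)
    have hu := upper_eq_of_pos_and_rank_eq h1
    have ha : a.upper = false := by
      by_contra hf
      exact h.1 (Ioi_subset_of_upper h1 (by simpa using hf))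
    exact ⟨h.ne, ha, hu ▸ ha, h1.1⟩
  · have key : ∀ {a b : Vertex w}, a ≠ b → a.upper = false → b.upper = false → a.pos = b.pos →
        ¬ Set.Ioi a ⊆ Set.Ioi b := by
      intro a b hne ha hb hp hsub
      let c : Vertex w := ⟨a.pos, true, a.side, fun i hi => absurd hi (ne_c_of_ne hne hp i)⟩
      have hc : c ∈ Set.Ioi a := (lt_iff_of_pos_eq (a := a) (b := c) rfl).2 ⟨ha, rfl, rfl⟩
      exact hne (ext hp (ha.trans hb.symm)
        ((lt_iff_of_pos_eq (b := c) hp.symm).1 (hsub hc)).2.2.symm)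
    rintro ⟨hne, ha, hb, hp⟩
    exact ⟨key hne ha hb hp, key hne.symm hb ha hp.symm⟩

/-- The nontrivial connected components of a disjoint union of complete graphs. -/
theorem nontrivial_supp_iff {V ι : Type*} {G : SimpleGraph V} {f : V → ι}
    {p : V → Prop} (hG : ∀ a b, G.Adj a b ↔ a ≠ b ∧ p a ∧ p b ∧ f a = f b) (A : Set V) :
    (A.Nontrivial ∧ ∃ K : G.ConnectedComponent, A = K.supp) ↔
      A.Nontrivial ∧ ∃ a, p a ∧ A = {b | p b ∧ f b = f a} := by
  have hreach : ∀ {a b}, p a → (G.Reachable b a ↔ p b ∧ f b = f a) := by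
    intro a b ha
    constructor
    · rintro ⟨q⟩
      induction q with
      | nil => exact ⟨ha, rfl⟩
      | cons h _ ih =>
        have h1 := (hG _ _).1 h
        exact ⟨h1.2.1, h1.2.2.2.trans (ih ha).2⟩
    · rintro ⟨hb, hf⟩
      by_cases hab : b = a
      · rw [hab]
      · exact SimpleGraph.Adj.reachable ((hG b a).2 ⟨hab, hb, ha, hf⟩)
  have hsupp : ∀ {a}, p a → (G.connectedComponentMk a).supp = {b | p b ∧ f b = f a} := by
    intro a ha
    ext b
    rw [SimpleGraph.ConnectedComponent.mem_supp_iff, SimpleGraph.ConnectedComponent.eq, hreach ha]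
    rfl
  refine and_congr_right fun hA => ⟨?_, ?_⟩
  · rintro ⟨K, rfl⟩
    obtain ⟨a, ha, b, hb, hab⟩ := hA
    rw [SimpleGraph.ConnectedComponent.mem_supp_iff] at ha hb
    subst ha
    rw [SimpleGraph.ConnectedComponent.eq] at hb
    have hpa : p a := by
      obtain ⟨q⟩ := hb.symm
      cases q with
      | nil => exact absurd rfl hab
      | cons h _ => exact ((hG _ _).1 h).2.1
    exact ⟨a, hpa, hsupp hpa⟩
  · rintro ⟨a, ha, rfl⟩
    exact ⟨_, (hsupp ha).symm⟩

theorem isTangle_iff {A B : Set (Vertex w)} : IsTangle A B ↔ ∃ k i, w.get k = .t i ∧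
    A = {a | a.upper = true ∧ a.pos = k} ∧ B = {b | b.upper = false ∧ b.pos = k} := by
  unfold IsTangle IsTangleTop IsTangleBottom
  rw [nontrivial_supp_iff (fun _ _ => topGraph_adj), nontrivial_supp_iff (fun _ _ => botGraph_adj)]
  constructor
  · rintro ⟨⟨-, x, hx, rfl⟩, ⟨-, y, -, rfl⟩, a, ha, a', ha', b, hb, b', hb', hba, hba', -, -, hab, -⟩
    -- For different letters, whether a bottom vertex lies below a top vertex depends only on ranks
    -- and positions, so `b < a` would force `b' < a`.
    have hpos : x.pos = y.pos := by
      by_contra hne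
      have h1 := rank_eq_of_pos_eq (ha.2.trans ha'.2.symm) (ha.1.trans ha'.1.symm)
      have h2 := rank_eq_of_pos_eq (hb.2.trans hb'.2.symm) (hb.1.trans hb'.1.symm)
      have h3 : ¬ b' < a := fun h => hab.2 h.le
      have h4 := Fin.val_ne_of_ne hne
      rw [lt_iff, hb'.2, ha.2] at h3
      rw [lt_iff, hb.2, ha.2] at hba
      omega
    cases hk : w.get x.pos with
    | c i => simp [(x.eq_false_of_c i hk).1] at hx
    | t i => exact ⟨x.pos, i, hk, rfl, by rw [hpos]⟩
  · rintro ⟨k, i, hk, rfl, rfl⟩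
    have hok : ∀ (u s : Bool) (j : ℕ), w.get k = .c j → u = false ∧ s = false := by
      intro u s j hj
      rw [hk] at hj
      cases hj
    let v (u s : Bool) : Vertex w := ⟨k, u, s, hok u s⟩
    have hlt : ∀ u s u' s', v u s < v u' s' ↔ u = false ∧ u' = true ∧ s = s' :=
      fun u s u' s' => lt_iff_of_pos_eq (w := w) (a := v u s) (b := v u' s') rfl
    have heq : ∀ u s u' s', v u s = v u' s' ↔ u = u' ∧ s = s' := by
      intro u s u' s'
      simp [v]
    have hinc : ∀ u s u' s', s ≠ s' → Incomp (v u s) (v u' s') := by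
      intro u s u' s' hs
      simp only [Incomp, le_iff_lt_or_eq, hlt, heq, hs, hs.symm, and_false, or_self,
        not_false_eq_true, and_self]
    have hne : ∀ u, v u false ≠ v u true := by simp [heq]
    refine ⟨⟨⟨v true false, ⟨rfl, rfl⟩, v true true, ⟨rfl, rfl⟩, hne _⟩, v true false, rfl, rfl⟩,
      ⟨⟨v false false, ⟨rfl, rfl⟩, v false true, ⟨rfl, rfl⟩, hne _⟩, v false false, rfl, rfl⟩,
      v true false, ⟨rfl, rfl⟩, v true true, ⟨rfl, rfl⟩, v false false, ⟨rfl, rfl⟩,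
      v false true, ⟨rfl, rfl⟩, ?_, ?_, hinc _ _ _ _ ?_, hinc _ _ _ _ ?_, hinc _ _ _ _ ?_,
      hinc _ _ _ _ ?_⟩ <;> simp [hlt]

theorem mem_untangled_iff {a : Vertex w} :
    a ∈ untangled (Vertex w) ↔ ∃ i, w.get a.pos = .c i := by
  change (¬ ∃ A B : Set (Vertex w), IsTangle A B ∧ a ∈ A ∪ B) ↔ _
  cases hk : w.get a.pos with
  | c i =>
    refine iff_of_true ?_ ⟨i, rfl⟩
    rintro ⟨A, B, hAB, ha⟩
    obtain ⟨k, j, hj, rfl, rfl⟩ := isTangle_iff.1 hAB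
    have : a.pos = k := ha.elim (fun h => h.2) fun h => h.2
    rw [← this, hk] at hj
    cases hj
  | t i =>
    refine iff_of_false (not_not.2 ⟨_, _, isTangle_iff.2 ⟨a.pos, i, hk, rfl, rfl⟩, ?_⟩) (by simp)
    cases hu : a.upper
    · exact Or.inr ⟨hu, rfl⟩
    · exact Or.inl ⟨hu, rfl⟩

/-- If `b` were higher, some vertex on the level of `a` would lie below `b`, hence below `a`. -/
theorem rank_le_of_view_eq (hw : Supported w) {a b : Vertex w} (h : view a = view b) :
    b.rank ≤ a.rank := by
  by_contra hlt
  obtain ⟨x, hx, hr⟩ := exists_lt_level_eq (a := b) (i := a.rank)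
    (by rw [level_eq_rank hw]; omega)
  have hxa : x ∈ Set.Iio a := by
    rw [show Set.Iio a = Set.Iio b from congrArg Prod.fst h]
    exact hx
  have := level_lt_level (Set.mem_Iio.1 hxa)
  rw [hr, level_eq_rank hw] at this
  omega

theorem isClone_iff (hw : Supported w) (hs : Separated w) {a b : Vertex w} {i j : ℕ}
    (ha : w.get a.pos = .c i) (hb : w.get b.pos = .c j) : IsClone a b ↔ a.pos = b.pos := by
  have ha' := a.eq_false_of_c i ha
  have hb' := b.eq_false_of_c j hb
  constructor
  · intro h
    have hr : a.rank = b.rank :=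
      le_antisymm (rank_le_of_view_eq hw h.symm) (rank_le_of_view_eq hw h)
    have hra := rank_of_c ha
    have hrb := rank_of_c hb
    obtain rfl : i = j := by omega
    clear hr
    have key : ∀ {a b : Vertex w}, view a = view b → a.rank = i → b.rank = i →
        w.get a.pos = .c i → w.get b.pos = .c i → ¬ a.pos.val < b.pos.val := by
      intro a b h hra hrb ha hb hlt
      obtain ⟨k, hk, hak, hkb, l, hm, hl⟩ :=
        hs a.pos.val b.pos.val a.pos.isLt b.pos.isLt i hlt ha hb
      -- A vertex of the separating letter tells the two apart: on the lower level it is below `b`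
      -- only, on the upper level above `a` only.
      obtain ⟨x, hx, hrx⟩ := exists_of_meets (k := ⟨k, hk⟩) hm
      have hxk : x.pos.val = k := congrArg Fin.val hx
      rcases hl with hl | hl
      · have h1 : x ∈ Set.Iio a := by
          rw [show Set.Iio a = Set.Iio b from congrArg Prod.fst h]
          exact lt_iff.2 (by omega)
        rw [Set.mem_Iio, lt_iff] at h1
        omega
      · have h1 : x ∈ Set.Ioi b := by
          rw [show Set.Ioi b = Set.Ioi a from compl_inj_iff.1 (congrArg Prod.snd h.symm)]
          exact lt_iff.2 (by omega)
        rw [Set.mem_Ioi, lt_iff] at h1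
        omega
    have h1 := key h hra hrb ha hb
    have h2 := key h.symm hrb hra hb ha
    exact Fin.ext (by omega)
  · intro h
    rw [ext h (ha'.1.trans hb'.1.symm) (ha'.2.trans hb'.2.symm)]
    rfl

/-- The part of the poset of a word that corresponds to a letter. -/
def partAt (k : Fin w.length) : Part (Vertex w) :=
  match w.get k with
  | .c _ => .clones {a | a.pos = k}
  | .t _ => .tangle {a | a.upper = true ∧ a.pos = k} {a | a.upper = false ∧ a.pos = k}

theorem partAt_of_c {k : Fin w.length} {i : ℕ} (h : w.get k = .c i) :
    partAt k = .clones {a | a.pos = k} := by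
  rw [partAt, h]

theorem partAt_of_t {k : Fin w.length} {i : ℕ} (h : w.get k = .t i) :
    partAt k = .tangle {a | a.upper = true ∧ a.pos = k} {a | a.upper = false ∧ a.pos = k} := by
  rw [partAt, h]

theorem mem_verts_partAt {k : Fin w.length} {a : Vertex w} : a ∈ (partAt k).verts ↔ a.pos = k := by
  cases h : w.get k with
  | c i => rw [partAt_of_c h]; rfl
  | t i =>
    rw [partAt_of_t h]
    simp only [Part.verts, Set.mem_union, Set.mem_ofPred_eq]
    cases a.upper <;> simp

theorem partAt_injective : Function.Injective (partAt (w := w)) := by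
  intro k k' h
  obtain ⟨a, ha, -⟩ := exists_of_meets (k := k) ⟨le_rfl, Letter.bot_le_top _⟩
  rw [← ha, ← mem_verts_partAt (w := w), ← h, mem_verts_partAt, ha]

theorem isPart_iff (hw : Supported w) (hs : Separated w) (p : Part (Vertex w)) :
    p.IsPart ↔ ∃ k, p = partAt k := by
  have hclone : ∀ {a : Vertex w} {i : ℕ}, w.get a.pos = .c i →
      {b | b ∈ untangled (Vertex w) ∧ IsClone a b} = {b | b.pos = a.pos} := by
    intro a i ha
    ext b
    simp only [Set.mem_ofPred_eq, mem_untangled_iff]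
    constructor
    · rintro ⟨⟨j, hj⟩, hab⟩
      exact ((isClone_iff hw hs ha hj).1 hab).symm
    · intro h
      have hb := ha
      rw [← h] at hb
      exact ⟨⟨i, hb⟩, (isClone_iff hw hs ha hb).2 h.symm⟩
  constructor
  · intro hp
    cases p with
    | clones C =>
      obtain ⟨a, ha, rfl⟩ := hp
      obtain ⟨i, hi⟩ := mem_untangled_iff.1 ha
      exact ⟨a.pos, by rw [partAt_of_c hi, hclone hi]⟩
    | tangle A B =>
      obtain ⟨k, i, hk, rfl, rfl⟩ := isTangle_iff.1 hp
      exact ⟨k, (partAt_of_t hk).symm⟩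
  · rintro ⟨k, rfl⟩
    cases hk : w.get k with
    | c i =>
      rw [partAt_of_c hk]
      obtain ⟨a, rfl, -⟩ := exists_of_meets (k := k) ⟨le_rfl, Letter.bot_le_top _⟩
      exact ⟨a, mem_untangled_iff.2 ⟨i, hk⟩, (hclone hk).symm⟩
    | t i =>
      rw [partAt_of_t hk]
      exact isTangle_iff.2 ⟨k, i, hk, rfl, rfl⟩

theorem hasLetter_partAt (hw : Supported w) (k : Fin w.length) :
    HasLetter (partAt k) (w.get k) := by
  cases hk : w.get k with
  | c i =>
    rw [partAt_of_c hk]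
    rintro a rfl
    rw [level_eq_rank hw, rank_of_c hk]
  | t i =>
    rw [partAt_of_t hk]
    constructor
    · rintro a ⟨hu, rfl⟩
      rw [level_eq_rank hw, rank_of_t hk, hu]; rfl
    · rintro a ⟨hu, rfl⟩
      rw [level_eq_rank hw, rank_of_t hk, hu]; rfl

theorem eq_get_of_hasLetter (hw : Supported w) {k : Fin w.length} {x : Letter}
    (h : HasLetter (partAt k) x) : w.get k = x := by
  obtain ⟨a, rfl, -⟩ := exists_of_meets (k := k) ⟨le_rfl, Letter.bot_le_top _⟩
  cases hk : w.get a.pos with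
  | c i =>
    rw [partAt_of_c hk] at h
    cases x with
    | c j =>
      have := h a rfl
      rw [level_eq_rank hw, rank_of_c hk] at this
      rw [this]
    | t j => exact h.elim
  | t i =>
    rw [partAt_of_t hk] at h
    cases x with
    | c j => exact h.elim
    | t j =>
      let b : Vertex w := ⟨a.pos, false, false, fun _ _ => ⟨rfl, rfl⟩⟩
      have := h.2 b ⟨rfl, rfl⟩
      rw [level_eq_rank hw, rank_of_t (a := b) hk] at this
      rw [← this]; rfl

theorem listedBefore_partAt (hw : Supported w) {k k' : Fin w.length} (h : k < k') :
    ListedBefore (partAt k) (partAt k') := by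
  intro a ha b hb
  rw [mem_verts_partAt] at ha hb
  subst ha hb
  have := Fin.lt_def.1 h
  rw [level_eq_rank hw, level_eq_rank hw, lt_iff, lt_iff]
  omega

theorem isListingWord_self (hw : Supported w) (hs : Separated w) : IsListingWord (Vertex w) w := by
  refine ⟨(List.finRange w.length).map partAt, isCompatibleListing_iff.2 ⟨?_, fun p => ?_, ?_⟩, ?_⟩
  · exact (List.nodup_finRange _).map partAt_injective
  · rw [isPart_iff hw hs, List.mem_map]
    simp only [List.mem_finRange, true_and, eq_comm]
  · rw [List.pairwise_map]
    exact (List.sortedLT_finRange _).pairwise.imp fun h => listedBefore_partAt hw h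
  · rw [List.forall₂_map_left_iff]
    conv => arg 3; rw [← List.map_get_finRange w]
    rw [List.forall₂_map_right_iff, List.forall₂_same]
    exact fun k _ => hasLetter_partAt hw k

end Vertex

/-! ### Uniqueness of the word of a compatible listing -/

theorem ofWord_map_orderedInsert {α : Type*} [LinearOrder α] (f : α → Letter) (a : α) (l : List α)
    (h : ∀ b ∈ l, (f a).Commutes (f b) ∨ a ≤ b) :
    ofWord ((l.orderedInsert (· ≤ ·) a).map f) = ofWord (f a :: l.map f) := by
  induction l with
  | nil => rfl
  | cons b l ih =>
    rw [List.orderedInsert_cons]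
    split_ifs with hab
    · rfl
    · have hc := (h b List.mem_cons_self).resolve_right hab
      rw [List.map_cons, ofWord_cons, ih fun b hb => h b (List.mem_cons_of_mem _ hb),
        ← ofWord_cons, ofWord_cons_cons_comm hc.symm]
      rfl

/-- Sorting only undoes inversions, and every inverted pair commutes. -/
theorem ofWord_map_insertionSort {α : Type*} [LinearOrder α] (f : α → Letter) (l : List α)
    (h : l.Pairwise fun a b => (f a).Commutes (f b) ∨ a ≤ b) :
    ofWord ((l.insertionSort (· ≤ ·)).map f) = ofWord (l.map f) := by
  induction l with
  | nil => rfl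
  | cons a l ih =>
    rw [List.pairwise_cons] at h
    rw [List.insertionSort_cons, ofWord_map_orderedInsert, ofWord_cons, ih h.2, ← ofWord_cons]
    · rfl
    · exact fun b hb => h.1 b ((List.mem_insertionSort _).1 hb)

theorem Letter.eq_c_or_exists_meets_of_not_commutes {x y : Letter} (h : ¬ x.Commutes y) :
    (∃ l, x = .c l ∧ y = .c l) ∨
      ∃ l l', x.Meets l ∧ y.Meets l' ∧ (l + 1 = l' ∨ l' + 1 = l) := by
  rw [Letter.commutes_iff] at h
  rcases x with i | i <;> rcases y with j | j <;>
    simp only [Letter.Meets, Letter.bot, Letter.top, Letter.c.injEq, reduceCtorEq, and_false,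
      false_and, exists_false, false_or] at h ⊢
  · by_cases hij : i = j
    · exact Or.inl ⟨i, rfl, hij.symm⟩
    · exact Or.inr ⟨i, j, by omega, by omega, by omega⟩
  · by_cases hij : i + 1 = j ∨ i = j + 1
    · exact ⟨i, j, by omega, by omega, by omega⟩
    · exact ⟨i, j + 1, by omega, by omega, by omega⟩
  · by_cases hij : i + 1 = j ∨ j + 1 = i
    · exact ⟨i, j, by omega, by omega, by omega⟩
    · exact ⟨i + 1, j, by omega, by omega, by omega⟩
  · by_cases hij : i = j + 2 ∨ i = j
    · exact ⟨i, j + 1, by omega, by omega, by omega⟩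
    · by_cases hij' : i + 1 = j ∨ j + 1 = i
      · exact ⟨i, j, by omega, by omega, by omega⟩
      · exact ⟨i + 1, j, by omega, by omega, by omega⟩

namespace Vertex

variable {w : List Letter}

/-- Vertices on adjacent levels are compared according to the order of listing, so the poset
remembers which letter came first. -/
theorem lt_of_listedBefore (hw : Supported w) {k k' : Fin w.length} (hne : k ≠ k')
    (h : ListedBefore (partAt k) (partAt k')) {l l' : ℕ} (hl : (w.get k).Meets l)
    (hl' : (w.get k').Meets l') (hll : l + 1 = l' ∨ l' + 1 = l) : k < k' := by
  obtain ⟨a, rfl, rfl⟩ := exists_of_meets hl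
  obtain ⟨b, rfl, rfl⟩ := exists_of_meets hl'
  have h := h a (mem_verts_partAt.2 rfl) b (mem_verts_partAt.2 rfl)
  rw [level_eq_rank hw, level_eq_rank hw, lt_iff, lt_iff] at h
  have := Fin.val_ne_of_ne hne
  rw [Fin.lt_def]
  omega

/-- A listing permutes the positions of `w`. Non-commuting letters with adjacent levels keep their
order, so it remains to exclude an inversion of two equal letters `c l`. -/
theorem ofWord_eq_of_isListingWord (hw : Supported w) (hs : Separated w) {v : List Letter}
    (hv : IsListingWord (Vertex w) v) : ofWord v = ofWord w := by
  obtain ⟨X, hX, hXv⟩ := hv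
  obtain ⟨hnd, hmem, hpw⟩ := isCompatibleListing_iff.1 hX
  obtain ⟨σ, rfl⟩ : ∃ σ : List (Fin w.length), σ.map partAt = X := by
    have : X ∈ Set.range (List.map (partAt (w := w))) := by
      rw [Set.range_list_map]
      intro p hp
      obtain ⟨k, rfl⟩ := (isPart_iff hw hs p).1 ((hmem p).1 hp)
      exact ⟨k, rfl⟩
    exact this
  rw [List.forall₂_map_left_iff] at hXv
  have hv : σ.map w.get = v := by
    rw [← List.forall₂_eq_eq_eq, List.forall₂_map_left_iff]
    exact hXv.imp fun _ _ h => eq_get_of_hasLetter hw h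
  have hσ : ∀ k, k ∈ σ := fun k => by
    obtain ⟨k', hk', h⟩ := List.mem_map.1 ((hmem (partAt k)).2 ((isPart_iff hw hs _).2 ⟨k, rfl⟩))
    rwa [← partAt_injective h]
  have hσnd : σ.Nodup := hnd.of_map _
  rw [List.pairwise_map, List.pairwise_iff_getElem] at hpw
  have hpair : σ.Pairwise fun a b => (w.get a).Commutes (w.get b) ∨ a ≤ b := by
    rw [List.pairwise_iff_getElem]
    intro i j hi hj hij
    by_contra hcon
    push Not at hcon
    obtain ⟨hcon, hlt⟩ := hcon
    have hne : σ[i] ≠ σ[j] := fun h => hij.ne ((List.Nodup.getElem_inj_iff hσnd).1 h)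
    rcases Letter.eq_c_or_exists_meets_of_not_commutes hcon with
      ⟨l, h1, h2⟩ | ⟨l, l', h1, h2, h3⟩
    · obtain ⟨k, hk, hjk, hki, l', hm, hl'⟩ :=
        hs σ[j].val σ[i].val σ[j].isLt σ[i].isLt l (Fin.lt_def.1 hlt) h2 h1
      obtain ⟨r, hr, hrk⟩ := List.mem_iff_getElem.1 (hσ ⟨k, hk⟩)
      have hmr : (w.get σ[r]).Meets l' := by rw [hrk]; exact hm
      have hml : ∀ {s : ℕ} (hs' : s < σ.length), w.get σ[s] = .c l → (w.get σ[s]).Meets l := by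
        intro s hs' h
        rw [h]
        exact ⟨le_rfl, le_rfl⟩
      have hrv : σ[r].val = k := congrArg Fin.val hrk
      rcases lt_trichotomy r j with hrj | rfl | hrj
      · have := lt_of_listedBefore hw (fun h => ?_) (hpw r j hr hj hrj) hmr (hml hj h2)
          (by omega)
        · rw [Fin.lt_def] at this; omega
        · have := congrArg Fin.val h; omega
      · omega
      · have := lt_of_listedBefore hw (fun h => ?_) (hpw i r hi hr (hij.trans hrj)) (hml hi h1) hmr
          (by omega)
        · rw [Fin.lt_def] at this; omega
        · have := congrArg Fin.val h; omega
    · exact lt_asymm hlt (lt_of_listedBefore hw hne (hpw i j hi hj hij) h1 h2 h3)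
  rw [← hv, ← ofWord_map_insertionSort _ _ hpair]
  have hsort : σ.insertionSort (· ≤ ·) = List.finRange w.length := by
    refine List.Perm.eq_of_pairwise' (r := (· ≤ ·)) (List.pairwise_insertionSort _ _)
      (List.sortedLT_finRange _).sortedLE.pairwise ((List.perm_insertionSort _ _).trans ?_)
    rw [List.perm_ext_iff_of_nodup hσnd (List.nodup_finRange _)]
    exact fun k => iff_of_true (hσ k) (List.mem_finRange k)
  rw [hsort, List.map_get_finRange]

end Vertex

theorem Reduced.ofWord_mem_skeleta {w : List Letter} (h : Reduced 0 w) : ofWord w ∈ skeleta := by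
  refine ⟨Vertex w, inferInstance, inferInstance, Vertex.isThreePlusOneFree, ?_⟩
  ext v
  constructor
  · exact fun hv => Vertex.ofWord_eq_of_isListingWord h.supported h.separated hv
  · intro hv
    change IsListingWord (Vertex w) v
    rw [isListingWord_iff_of_ofWord_eq hv]
    exact Vertex.isListingWord_self h.supported h.separated

/-! ### Enumeration of skeleta -/

theorem weight_ofWord (w : List Letter) :
    (weight (ofWord w)).toAdd = (wordWeight w 0, wordWeight w 1) := by
  induction w with
  | nil => rw [show weight (ofWord []) = 1 from map_one weight]; rfl
  | cons x w ih =>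
    rw [ofWord_cons, map_mul, toAdd_mul, ih]
    cases x <;>
    · rw [show weight (ofWord [_]) = _ from mul_one _]
      simp [wordWeight]

theorem skeletaWith_eq_image (d : Fin 2 →₀ ℕ) :
    skeletaWith (d 0) (d 1) = ofWord '' {w | w ∈ {w | Reduced 0 w} ∧ wordWeight w = d} := by
  have hd : ∀ w, (numCloneSets (ofWord w) = d 0 ∧ numTangles (ofWord w) = d 1) ↔
      wordWeight w = d := by
    intro w
    rw [numCloneSets, numTangles, weight_ofWord, Finsupp.ext_iff, Fin.forall_fin_two]
  ext m
  constructor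
  · rintro ⟨hm, hrs⟩
    refine ⟨normalForm m, ⟨Reduced.of_mem_skeleta hm, (hd _).1 ?_⟩, ofWord_normalForm m⟩
    rwa [ofWord_normalForm]
  · rintro ⟨w, ⟨hw, hwd⟩, rfl⟩
    exact ⟨Reduced.ofWord_mem_skeleta hw, (hd w).2 hwd⟩

theorem injOn_ofWord_reduced (m : ℕ) : Set.InjOn ofWord {w | Reduced m w} := by
  intro u hu v hv h
  rw [← Normal.normalForm_ofWord hu.normal, h, Normal.normalForm_ofWord hv.normal]

theorem skeletaSeries_eq : skeletaSeries = reducedSeries 0 := by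
  funext d
  change ((skeletaWith (d 0) (d 1)).ncard : ℚ) = (Set.ncard {w | _ ∧ _} : ℚ)
  rw [skeletaWith_eq_image, Set.InjOn.ncard_image]
  exact (injOn_ofWord_reduced 0).mono fun w hw => hw.1

theorem finite_skeletaWith (r s : ℕ) : (skeletaWith r s).Finite := by
  have := skeletaWith_eq_image (Finsupp.single 0 r + Finsupp.single 1 s)
  simp only [Finsupp.add_apply, Finsupp.single_apply] at this
  simp only [if_true, zero_ne_one, one_ne_zero, if_false, add_zero, zero_add] at this
  rw [this]
  exact (finiteFibers_reduced 0 _).image _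

end ThreePlusOne

theorem mainTheorem5 :
    (∀ r s : ℕ, (ThreePlusOne.skeletaWith r s).Finite) ∧
    ∀ F : MvPowerSeries (Fin 2) ℚ,
      F = ThreePlusOne.skeletaSeries ↔
        F = 1 + MvPowerSeries.X 0 * (1 + MvPowerSeries.X 0)⁻¹ * F ^ 2
              + MvPowerSeries.X 1 * F ^ 3 := by
  refine ⟨ThreePlusOne.finite_skeletaWith, fun F => ?_⟩
  rw [ThreePlusOne.skeletaSeries_eq]
  constructor
  · rintro rfl
    exact ThreePlusOne.reducedSeries_zero_eq
  · intro h
    exact ThreePlusOne.eq_of_functional_equation h ThreePlusOne.reducedSeries_zero_eq
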